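/- Let $n\ge 1$, $d\ge 0$, $R_\omega\ge 0$, $R_\lambda\ge 0$, $\delta\in(0,1)$, and let $\mathcal D$ be a probability distribution on $\mathbb R^d\times\{\pm1\}$. Let $S=\{(x_i,y_i)\}_{i=1}^n$ be drawn i.i.d. from $\mathcal D$, and put $R_x=\max_i\|x_i\|_2$. For a finite symmetric non-negative measure $\lambda$ on $\mathbb R^d$ let $k_\lambda(x,x')=\int e^{i\langle\omega,x-x'\rangle}\,d\lambda(\omega)$ be the translation-invariant kernel with dual measure $\lambda$, and write $\|\lambda\|_1=\lambda(\mathbb R^d)$. An SVM decision function with kernel $k_\lambda$ trained on $S$ is a function $f(x)=\sum_{j=1}^n\alpha_j k_\lambda(x,x_j)$ with $\alpha\in\mathbb R^n$ normalized by $\alpha^\top G\alpha\le 1$, where $G_{ij}=k_\lambda(x_i,x_j)$. Then, with probability at least $1-\delta$ over $S$, the following holds simultaneously for all such $\lambda$ with $\|\lambda\|_1\le R_\lambda$ and $\lambda(\{\|\omega\|_2>R_\omega\})=0$, all SVM decision functions $f$ with kernel $k_\lambda$ trained on $S$, and all $\theta>0$: \[ \Pr_{(x,y)\sim\mathcal D}\bigl[y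 f(x)\le 0\bigr]\;\le\;\frac1n\sum_{i=1}^n \mathbf 1_{\{y_i f(x_i)\le\theta\}}+\frac{6R_\omega R_x}{\theta}\sqrt{\frac{R_\lambda}{n}}+3\sqrt{\frac{\log(2/\delta)}{n}} . \] -/

import Mathlib

open MeasureTheory
open scoped Matrix

/-- `lam` is a dual measure of the translation-invariant kernel `k` on `ℝ^d`: a finite, symmetric,
non-negative measure with `k x x' = ∫ exp (i ⟨ω, x - x'⟩) dlam(ω)` for all `x, x'`. -/
structure IsDualMeasure {d : ℕ}
    (k : EuclideanSpace ℝ (Fin d) → EuclideanSpace ℝ (Fin d) → ℝ)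
    (lam : Measure (EuclideanSpace ℝ (Fin d))) : Prop where
  finite : IsFiniteMeasure lam
  symm : lam.map (fun ω => -ω) = lam
  eq_integral : ∀ x x' : EuclideanSpace ℝ (Fin d),
    (k x x' : ℂ) = ∫ ω, Complex.exp (Complex.I * (inner ℝ ω (x - x') : ℝ)) ∂lam

/-- The Gram matrix of the kernel `k` at the points `x`. -/
def gramMatrix {X : Type*} {n : ℕ} (k : X → X → ℝ) (x : Fin n → X) : Matrix (Fin n) (Fin n) ℝ :=
  Matrix.of fun i j => k (x i) (x j)

/-- `f` is a (normalized) SVM decision function with kernel `k` and training inputs `x`: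
`f = ∑ j, α j * k (·) (x j)` with signed weights satisfying `αᵀ G α ≤ 1`. -/
def IsSVMDecisionFunction {X : Type*} {n : ℕ} (k : X → X → ℝ) (x : Fin n → X) (f : X → ℝ) :
    Prop :=
  ∃ α : Fin n → ℝ, α ⬝ᵥ (gramMatrix k x *ᵥ α) ≤ 1 ∧ ∀ z, f z = ∑ j, α j * k z (x j)

/-- The norm of the data, `max_i ‖x_i‖`, of a labelled sample. -/
noncomputable def dataNorm {d n : ℕ} (S : Fin n → EuclideanSpace ℝ (Fin d) × ℝ) : ℝ :=
  ⨆ i, ‖(S i).1‖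

/-- The empirical `θ`-margin error: the fraction of sample points with `y_i f(x_i) ≤ θ`. -/
noncomputable def empiricalMarginError {X : Type*} {n : ℕ} (S : Fin n → X × ℝ) (f : X → ℝ)
    (θ : ℝ) : ℝ :=
  (1 / (n : ℝ)) * ∑ i, Set.indicator {z : X × ℝ | z.2 * f z.1 ≤ θ} (fun _ => (1 : ℝ)) (S i)

/-! Writing the kernel through its dual measure gives `f z = ∫ exp(i⟨ω,z⟩) h(ω) dλ` with `∫ ‖h‖² dλ
= αᵀGα ≤ 1`, hence `∫ ‖h‖ dλ ≤ √Rlam`. A linear combination of the values `f(x_i) - f(0)` is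
therefore at most `√Rlam` times the largest modulus, over `‖ω‖ ≤ Rω`, of the same combination of
`exp(i⟨ω,x_i⟩) - 1`. Since `sin` and `cos - 1` are 1-Lipschitz and vanish at 0, the contraction
principle bounds the Rademacher average of that maximum by `2 Rω R √n` for points in a ball of
radius `R`, whatever the dimension (`exists_bound_exp_sub_one`). `frequencyClass` keeps only this
domination property, so a single class serves all kernels, measures and weights. Symmetrization and
McDiarmid's inequality then give a uniform deviation bound for ramp losses.

Three quantities are not fixed before sampling. The radius `dataNorm S` is replaced by a quantile
`R` of the norm, which with high probability is at most `dataNorm S` and whose excess mass is only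
`log(2/δ)/n`. The offset `f(0)/θ`, which centring leaves uncontrolled, is clamped and rounded to a
grid, the ramp absorbing the error. The scale `Λ = √Rlam Rω R/θ`, through which `θ` enters, is
rounded up to a multiple of 1/10. A union bound over scales and offsets costs half of `δ`, the
quantile the other half. -/

/-! ### Random signs and the contraction principle -/

/-- The sign `±1` encoded by a Boolean. -/
def boolSign (b : Bool) : ℝ := if b then 1 else -1

lemma boolSign_not (b : Bool) : boolSign (!b) = -boolSign b := by
  cases b <;> simp [boolSign]

lemma boolSign_mul_self (b : Bool) : boolSign b * boolSign b = 1 := by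
  cases b <;> simp [boolSign]

/-- Flipping one coordinate of a sign vector. -/
def flipSign {ι : Type*} [DecidableEq ι] (i : ι) : (ι → Bool) ≃ (ι → Bool) :=
  Function.Involutive.toPerm (fun σ => Function.update σ i (!σ i)) (by
    intro σ
    simp)

lemma flipSign_apply_same {ι : Type*} [DecidableEq ι] (i : ι) (σ : ι → Bool) :
    flipSign i σ i = !σ i :=
  Function.update_self _ _ _

lemma flipSign_apply_of_ne {ι : Type*} [DecidableEq ι] {i j : ι} (h : j ≠ i) (σ : ι → Bool) :
    flipSign i σ j = σ j :=
  Function.update_of_ne h _ _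

lemma sum_flipSign {ι : Type*} [Fintype ι] [DecidableEq ι] (i : ι) (H : (ι → Bool) → ℝ) :
    ∑ σ, H (flipSign i σ) = ∑ σ, H σ :=
  Equiv.sum_comp (flipSign i) H

/-- If `q < b ≤ a ≤ p`, then `a ≤ p + q - b`, and both `b` and `p + q - b` lie in `[q, p]`; adding
the two chord inequalities gives the claim. If `b ≤ q`, monotonicity suffices. -/
lemma ConvexOn.add_le_add_of_weak_majorization {F : ℝ → ℝ} (hF : ConvexOn ℝ Set.univ F)
    (hm : Monotone F) {a b p q : ℝ} (ha : a ≤ max p q) (hb : b ≤ max p q)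
    (hab : a + b ≤ p + q) : F a + F b ≤ F p + F q := by
  wlog h : q ≤ p generalizing p q
  · rw [add_comm (F p)]
    exact this (by rwa [max_comm]) (by rwa [max_comm]) (by linarith) (le_of_not_ge h)
  wlog h' : b ≤ a generalizing a b
  · rw [add_comm (F a)]
    exact this hb ha (by linarith) (le_of_not_ge h')
  rw [max_eq_left h] at ha hb
  rcases le_or_gt b q with hbq | hbq
  · linarith [hm ha, hm hbq]
  have hpq : 0 < p - q := by linarith
  have key : ∀ x, q ≤ x → x ≤ p → F x ≤ (x - q) / (p - q) * F p + (p - x) / (p - q) * F q := by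
    intro x h1 h2
    have := hF.2 (Set.mem_univ p) (Set.mem_univ q)
      (div_nonneg (sub_nonneg.2 h1) hpq.le) (div_nonneg (sub_nonneg.2 h2) hpq.le)
      (by field_simp; ring)
    have hx : (x - q) / (p - q) * p + (p - x) / (p - q) * q = x := by
      field_simp
      ring
    simpa only [smul_eq_mul, hx] using this
  have h1 := key b hbq.le hb
  have h2 := key (p + q - b) (by linarith) (by linarith)
  have h3 : F a ≤ F (p + q - b) := hm (by linarith)
  have h4 : (b - q) / (p - q) * F p + (p - b) / (p - q) * F q
      + ((p + q - b - q) / (p - q) * F p + (p - (p + q - b)) / (p - q) * F q) = F p + F q := by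
    field_simp
    ring
  linarith

lemma le_iSup_of_finite {T : Type*} [Finite T] (f : T → ℝ) (τ : T) : f τ ≤ ⨆ τ, f τ :=
  le_ciSup (Set.finite_range f).bddAbove τ

/-- Contraction in one coordinate: `u` collects the other coordinates. Maximizers of the two left
suprema satisfy the weak majorization hypotheses, the individual bounds coming from `h0` and the
bound on the sum from `hL`. -/
lemma ConvexOn.iSup_add_contraction {T : Type*} [Finite T] [Nonempty T] {F : ℝ → ℝ}
    (hF : ConvexOn ℝ Set.univ F) (hm : Monotone F) (u v w : T → ℝ)
    (h0 : ∀ τ, |w τ| ≤ |v τ|) (hL : ∀ τ τ', |w τ - w τ'| ≤ |v τ - v τ'|) :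
    F (⨆ τ, (u τ + w τ)) + F (⨆ τ, (u τ - w τ))
      ≤ F (⨆ τ, (u τ + v τ)) + F (⨆ τ, (u τ - v τ)) := by
  obtain ⟨τ₁, h₁⟩ := exists_eq_ciSup_of_finite (f := fun τ => u τ + w τ)
  obtain ⟨τ₂, h₂⟩ := exists_eq_ciSup_of_finite (f := fun τ => u τ - w τ)
  have hp := le_iSup_of_finite (fun τ => u τ + v τ)
  have hq := le_iSup_of_finite (fun τ => u τ - v τ)
  set p := ⨆ τ, (u τ + v τ)
  set q := ⨆ τ, (u τ - v τ)
  rw [← h₁, ← h₂]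
  have habs : ∀ τ, u τ + |v τ| ≤ max p q := by
    intro τ
    rcases abs_cases (v τ) with ⟨h, _⟩ | ⟨h, _⟩
    · rw [h]; exact (hp τ).trans (le_max_left _ _)
    · rw [h]; exact (hq τ).trans (le_max_right _ _)
  refine hF.add_le_add_of_weak_majorization hm ?_ ?_ ?_
  · have := habs τ₁
    have := le_abs_self (w τ₁)
    linarith [h0 τ₁]
  · have := habs τ₂
    have := neg_abs_le (w τ₂)
    linarith [h0 τ₂]
  · have h := (le_abs_self _).trans (hL τ₁ τ₂)
    have a1 := hp τ₁
    have a2 := hp τ₂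
    have a3 := hq τ₁
    have a4 := hq τ₂
    rcases abs_cases (v τ₁ - v τ₂) with ⟨h', _⟩ | ⟨h', _⟩ <;> rw [h'] at h <;> linarith

/-- The Ledoux–Talagrand contraction principle for a finite index set. -/
theorem ConvexOn.sum_iSup_contraction {ι T : Type*} [Fintype ι] [DecidableEq ι] [Finite T]
    [Nonempty T] {F : ℝ → ℝ} (hF : ConvexOn ℝ Set.univ F) (hm : Monotone F) (v w : T → ι → ℝ)
    (h0 : ∀ τ i, |w τ i| ≤ |v τ i|) (hL : ∀ τ τ' i, |w τ i - w τ' i| ≤ |v τ i - v τ' i|) :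
    ∑ σ : ι → Bool, F (⨆ τ, ∑ i, boolSign (σ i) * w τ i)
      ≤ ∑ σ : ι → Bool, F (⨆ τ, ∑ i, boolSign (σ i) * v τ i) := by
  have key : ∀ s : Finset ι, ∑ σ : ι → Bool, F (⨆ τ, ∑ i, boolSign (σ i) * w τ i)
      ≤ ∑ σ : ι → Bool, F (⨆ τ, ∑ i, boolSign (σ i) * (if i ∈ s then v τ i else w τ i)) := by
    intro s
    induction s using Finset.induction_on with
    | empty => simp
    | insert j s hj ih =>
      refine ih.trans ?_
      -- Doubling both sums allows each `σ` to be paired with its flip at `j`, which leaves the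
      -- other coordinates unchanged.
      rw [← mul_le_mul_iff_right₀ (two_pos : (0 : ℝ) < 2), two_mul, two_mul]
      nth_rewrite 2 [← sum_flipSign j]
      nth_rewrite 4 [← sum_flipSign j]
      rw [← Finset.sum_add_distrib, ← Finset.sum_add_distrib]
      refine Finset.sum_le_sum fun σ _ => ?_
      set u : T → ℝ := fun τ => ∑ i ∈ Finset.univ.erase j,
        boolSign (σ i) * (if i ∈ s then v τ i else w τ i) with hu
      have e1 : ∀ τ, ∑ i, boolSign (σ i) * (if i ∈ s then v τ i else w τ i)
          = u τ + boolSign (σ j) * w τ j := by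
        intro τ
        rw [← Finset.sum_erase_add _ _ (Finset.mem_univ j), if_neg hj]
      have e2 : ∀ τ, ∑ i, boolSign (flipSign j σ i) * (if i ∈ s then v τ i else w τ i)
          = u τ - boolSign (σ j) * w τ j := by
        intro τ
        rw [← Finset.sum_erase_add _ _ (Finset.mem_univ j), if_neg hj, flipSign_apply_same,
          boolSign_not, neg_mul, ← sub_eq_add_neg]
        congr 1
        refine Finset.sum_congr rfl fun i hi => ?_
        rw [flipSign_apply_of_ne (Finset.ne_of_mem_erase hi)]
      have e3 : ∀ τ, ∑ i, boolSign (σ i) * (if i ∈ insert j s then v τ i else w τ i)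
          = u τ + boolSign (σ j) * v τ j := by
        intro τ
        rw [← Finset.sum_erase_add _ _ (Finset.mem_univ j), if_pos (Finset.mem_insert_self j s)]
        congr 1
        refine Finset.sum_congr rfl fun i hi => ?_
        simp [Finset.ne_of_mem_erase hi]
      have e4 : ∀ τ, ∑ i, boolSign (flipSign j σ i) * (if i ∈ insert j s then v τ i else w τ i)
          = u τ - boolSign (σ j) * v τ j := by
        intro τ
        rw [← Finset.sum_erase_add _ _ (Finset.mem_univ j), if_pos (Finset.mem_insert_self j s),
          flipSign_apply_same, boolSign_not, neg_mul, ← sub_eq_add_neg]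
        congr 1
        refine Finset.sum_congr rfl fun i hi => ?_
        rw [flipSign_apply_of_ne (Finset.ne_of_mem_erase hi)]
        simp [Finset.ne_of_mem_erase hi]
      simp only [e1, e2, e3, e4]
      have hs : |boolSign (σ j)| = 1 := by cases σ j <;> simp [boolSign]
      refine hF.iSup_add_contraction hm u _ _ ?_ ?_
      · intro τ
        rw [abs_mul, abs_mul, hs, one_mul, one_mul]
        exact h0 τ j
      · intro τ τ'
        rw [← mul_sub, ← mul_sub, abs_mul, abs_mul, hs, one_mul, one_mul]
        exact hL τ τ' j
  simpa using key Finset.univ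

/-! ### Second moments of Rademacher sums of vectors and exponentials -/

lemma sum_boolSign_mul {ι : Type*} [Fintype ι] [DecidableEq ι] (i j : ι) :
    ∑ σ : ι → Bool, boolSign (σ i) * boolSign (σ j)
      = if i = j then (Fintype.card (ι → Bool) : ℝ) else 0 := by
  split_ifs with h
  · subst h
    simp [boolSign_mul_self]
  · have := sum_flipSign i (fun σ => boolSign (σ i) * boolSign (σ j))
    simp only [flipSign_apply_same, flipSign_apply_of_ne (Ne.symm h), boolSign_not, neg_mul,
      Finset.sum_neg_distrib] at this
    linarith

lemma sum_boolSign {ι : Type*} [Fintype ι] [DecidableEq ι] (i : ι) :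
    ∑ σ : ι → Bool, boolSign (σ i) = 0 := by
  have := sum_flipSign i (fun σ => boolSign (σ i))
  simp only [flipSign_apply_same, boolSign_not, Finset.sum_neg_distrib] at this
  linarith

lemma sum_norm_sq_boolSign_smul {ι E : Type*} [Fintype ι] [DecidableEq ι]
    [NormedAddCommGroup E] [InnerProductSpace ℝ E] (x : ι → E) :
    ∑ σ : ι → Bool, ‖∑ i, boolSign (σ i) • x i‖ ^ 2
      = Fintype.card (ι → Bool) * ∑ i, ‖x i‖ ^ 2 := by
  simp only [← real_inner_self_eq_norm_sq, sum_inner, inner_sum, real_inner_smul_left,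
    real_inner_smul_right]
  rw [Finset.sum_comm, Finset.mul_sum]
  refine Finset.sum_congr rfl fun i _ => ?_
  rw [Finset.sum_comm]
  have : ∀ j, ∑ σ : ι → Bool, boolSign (σ i) * (boolSign (σ j) * inner ℝ (x j) (x i))
      = (if i = j then (Fintype.card (ι → Bool) : ℝ) else 0) * inner ℝ (x j) (x i) := by
    intro j
    rw [← sum_boolSign_mul, Finset.sum_mul]
    exact Finset.sum_congr rfl fun σ _ => by ring
  simp only [← mul_assoc] at this ⊢
  simp [this]

lemma convexOn_sq_posPart : ConvexOn ℝ Set.univ (fun x : ℝ => (max x 0) ^ 2) := by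
  have h : ConvexOn ℝ Set.univ (fun x : ℝ => max x 0) :=
    (convexOn_id convex_univ).sup (convexOn_const 0 convex_univ)
  exact h.pow (fun x _ => le_max_right _ _) 2

lemma monotone_sq_posPart : Monotone (fun x : ℝ => (max x 0) ^ 2) := by
  intro x y h
  have : max x 0 ≤ max y 0 := max_le_max_right 0 h
  exact pow_le_pow_left₀ (le_max_right _ _) this 2

lemma norm_sq_sum_exp_sub_one {ι : Type*} [Fintype ι] (a t : ι → ℝ) :
    ‖∑ i, (a i : ℂ) * (Complex.exp (Complex.I * (t i : ℝ)) - 1)‖ ^ 2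
      = (∑ i, a i * (Real.cos (t i) - 1)) ^ 2 + (∑ i, a i * Real.sin (t i)) ^ 2 := by
  rw [← Complex.normSq_eq_norm_sq, Complex.normSq_apply, Complex.re_sum, Complex.im_sum]
  have h1 : ∀ i, ((a i : ℂ) * (Complex.exp (Complex.I * (t i : ℝ)) - 1)).re
      = a i * (Real.cos (t i) - 1) := by
    intro i
    rw [mul_comm Complex.I, Complex.re_ofReal_mul, Complex.sub_re, Complex.exp_ofReal_mul_I_re,
      Complex.one_re]
  have h2 : ∀ i, ((a i : ℂ) * (Complex.exp (Complex.I * (t i : ℝ)) - 1)).im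
      = a i * Real.sin (t i) := by
    intro i
    rw [mul_comm Complex.I, Complex.im_ofReal_mul, Complex.sub_im, Complex.exp_ofReal_mul_I_im,
      Complex.one_im, sub_zero]
  simp only [h1, h2]
  ring

lemma sq_eq_sq_posPart_add (z : ℝ) : z ^ 2 = (max z 0) ^ 2 + (max (-z) 0) ^ 2 := by
  rcases le_total 0 z with h | h
  · rw [max_eq_left h, max_eq_right (by linarith)]; ring
  · rw [max_eq_right h, max_eq_left (by linarith)]; ring

section ExponentialSums

variable {ι E : Type*} [Fintype ι] [DecidableEq ι] [NormedAddCommGroup E] [InnerProductSpace ℝ E]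

/-- The frequency may depend on the signs because a supremum over the finitely many `ω τ` dominates
it. The squared positive part is convex and increasing, so contraction removes `φ` directly at the
level of second moments, and Cauchy–Schwarz and orthogonality of the signs finish. -/
lemma sum_sq_posPart_contraction (x : ι → E) {r : ℝ} (ω : (ι → Bool) → E) (hω : ∀ σ, ‖ω σ‖ ≤ r)
    {φ : ℝ → ℝ} (h0 : φ 0 = 0) (hφ : ∀ s t, |φ s - φ t| ≤ |s - t|) :
    ∑ σ : ι → Bool, (max (∑ i, boolSign (σ i) * φ (inner ℝ (ω σ) (x i))) 0) ^ 2
      ≤ Fintype.card (ι → Bool) * (r ^ 2 * ∑ i, ‖x i‖ ^ 2) := by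
  calc ∑ σ : ι → Bool, (max (∑ i, boolSign (σ i) * φ (inner ℝ (ω σ) (x i))) 0) ^ 2
      ≤ ∑ σ : ι → Bool,
          (max (⨆ τ, ∑ i, boolSign (σ i) * φ (inner ℝ (ω τ) (x i))) 0) ^ 2 :=
        Finset.sum_le_sum fun σ _ => monotone_sq_posPart
          (le_iSup_of_finite (fun τ => ∑ i, boolSign (σ i) * φ (inner ℝ (ω τ) (x i))) σ)
    _ ≤ ∑ σ : ι → Bool, (max (⨆ τ, ∑ i, boolSign (σ i) * inner ℝ (ω τ) (x i)) 0) ^ 2 :=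
        convexOn_sq_posPart.sum_iSup_contraction monotone_sq_posPart
          (fun τ i => inner ℝ (ω τ) (x i)) (fun τ i => φ (inner ℝ (ω τ) (x i)))
          (fun τ i => by simpa [h0] using hφ (inner ℝ (ω τ) (x i)) 0) (fun τ τ' i => hφ _ _)
    _ ≤ ∑ σ : ι → Bool, r ^ 2 * ‖∑ i, boolSign (σ i) • x i‖ ^ 2 := by
        refine Finset.sum_le_sum fun σ _ => ?_
        rw [← mul_pow]
        have hr : 0 ≤ r := (norm_nonneg _).trans (hω σ)
        refine pow_le_pow_left₀ (le_max_right _ _) (max_le (ciSup_le fun τ => ?_) (by positivity)) 2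
        have : ∑ i, boolSign (σ i) * inner ℝ (ω τ) (x i)
            = inner ℝ (ω τ) (∑ i, boolSign (σ i) • x i) := by
          simp [inner_sum, real_inner_smul_right]
        rw [this]
        exact (real_inner_le_norm _ _).trans (by gcongr; exact hω τ)
    _ = Fintype.card (ι → Bool) * (r ^ 2 * ∑ i, ‖x i‖ ^ 2) := by
        rw [← Finset.mul_sum, sum_norm_sq_boolSign_smul]
        ring

/-- Second moment of a Rademacher sum of centred exponentials, at sign-dependent frequencies. -/
lemma sum_norm_sq_exp_sub_one_le (x : ι → E) {r : ℝ} (ω : (ι → Bool) → E)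
    (hω : ∀ σ, ‖ω σ‖ ≤ r) :
    ∑ σ : ι → Bool, ‖∑ i, (boolSign (σ i) : ℂ)
        * (Complex.exp (Complex.I * (inner ℝ (ω σ) (x i) : ℝ)) - 1)‖ ^ 2
      ≤ 4 * (Fintype.card (ι → Bool) * (r ^ 2 * ∑ i, ‖x i‖ ^ 2)) := by
  -- The squared modulus splits into four squared positive parts, those of `±` the real and `±` the
  -- imaginary part; each contributes once to the factor 4.
  have h1 := sum_sq_posPart_contraction x ω hω (φ := fun t => Real.cos t - 1) (by simp)
    (fun s t => by simpa using Real.abs_cos_sub_cos_le s t)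
  have h2 := sum_sq_posPart_contraction x ω hω (φ := fun t => -(Real.cos t - 1)) (by simp)
    (fun s t => by
      rw [show -(Real.cos s - 1) - -(Real.cos t - 1) = -(Real.cos s - Real.cos t) by ring, abs_neg]
      exact Real.abs_cos_sub_cos_le s t)
  have h3 := sum_sq_posPart_contraction x ω hω (φ := fun t => Real.sin t) (by simp)
    (fun s t => Real.abs_sin_sub_sin_le s t)
  have h4 := sum_sq_posPart_contraction x ω hω (φ := fun t => -Real.sin t) (by simp)
    (fun s t => by
      rw [show -Real.sin s - -Real.sin t = -(Real.sin s - Real.sin t) by ring, abs_neg]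
      exact Real.abs_sin_sub_sin_le s t)
  have e : ∀ σ : ι → Bool, ‖∑ i, (boolSign (σ i) : ℂ)
        * (Complex.exp (Complex.I * (inner ℝ (ω σ) (x i) : ℝ)) - 1)‖ ^ 2
      = (max (∑ i, boolSign (σ i) * (Real.cos (inner ℝ (ω σ) (x i)) - 1)) 0) ^ 2
        + (max (∑ i, boolSign (σ i) * -(Real.cos (inner ℝ (ω σ) (x i)) - 1)) 0) ^ 2
        + ((max (∑ i, boolSign (σ i) * Real.sin (inner ℝ (ω σ) (x i))) 0) ^ 2
        + (max (∑ i, boolSign (σ i) * -Real.sin (inner ℝ (ω σ) (x i))) 0) ^ 2) := by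
    intro σ
    rw [norm_sq_sum_exp_sub_one, sq_eq_sq_posPart_add (∑ i, boolSign (σ i) * (Real.cos _ - 1)),
      sq_eq_sq_posPart_add (∑ i, boolSign (σ i) * Real.sin _)]
    simp only [mul_neg, Finset.sum_neg_distrib]
  simp only [e, Finset.sum_add_distrib]
  linarith

/-- Rademacher average of the largest modulus of an exponential sum with bounded frequencies. -/
lemma exists_bound_exp_sub_one [ProperSpace E] (x : ι → E) {r R : ℝ} (hr : 0 ≤ r) (hR : 0 ≤ R)
    (hx : ∀ i, ‖x i‖ ≤ R) :
    ∃ M : (ι → Bool) → ℝ, (∀ σ, 0 ≤ M σ) ∧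
      (∀ σ, ∀ ω : E, ‖ω‖ ≤ r → ‖∑ i, (boolSign (σ i) : ℂ)
        * (Complex.exp (Complex.I * (inner ℝ ω (x i) : ℝ)) - 1)‖ ≤ M σ) ∧
      ∑ σ, M σ ≤ Fintype.card (ι → Bool) * (2 * (r * R) * √(Fintype.card ι)) := by
  -- By compactness the maximum over the ball is attained at a sign-dependent frequency, to which
  -- the second moment bound applies.
  have hmax : ∀ σ : ι → Bool, ∃ ω₀ ∈ Metric.closedBall (0 : E) r,
      IsMaxOn (fun ω : E => ‖∑ i, (boolSign (σ i) : ℂ)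
        * (Complex.exp (Complex.I * (inner ℝ ω (x i) : ℝ)) - 1)‖) (Metric.closedBall 0 r) ω₀ := by
    intro σ
    refine (isCompact_closedBall (0 : E) r).exists_isMaxOn ⟨0, by simpa using hr⟩ ?_
    fun_prop
  choose ω hω hωmax using hmax
  have h := sum_norm_sq_exp_sub_one_le x ω (r := r) (fun σ => by simpa using hω σ)
  refine ⟨fun σ => ‖∑ i, (boolSign (σ i) : ℂ)
    * (Complex.exp (Complex.I * (inner ℝ (ω σ) (x i) : ℝ)) - 1)‖, fun σ => norm_nonneg _,
    fun σ ω' hω' => hωmax σ (by simpa using hω'), ?_⟩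
  -- Cauchy–Schwarz over the sign vectors turns the factor 4 for second moments into 2.
  refine le_of_sq_le_sq ?_ (by positivity)
  refine (sq_sum_le_card_mul_sum_sq).trans ?_
  rw [Finset.card_univ]
  have hsum : ∑ i, ‖x i‖ ^ 2 ≤ Fintype.card ι * R ^ 2 := by
    calc ∑ i, ‖x i‖ ^ 2 ≤ ∑ _i : ι, R ^ 2 :=
          Finset.sum_le_sum fun i _ => pow_le_pow_left₀ (norm_nonneg _) (hx i) 2
      _ = _ := by simp
  calc (Fintype.card (ι → Bool) : ℝ) * _
      ≤ Fintype.card (ι → Bool) * (4 * (Fintype.card (ι → Bool)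
          * (r ^ 2 * (Fintype.card ι * R ^ 2)))) := by
        gcongr
        exact h.trans (by gcongr)
    _ = _ := by
        rw [mul_pow, mul_pow _ (√_), Real.sq_sqrt (by positivity)]
        ring

end ExponentialSums

/-! ### Hoeffding's lemma and McDiarmid's inequality -/

section BoundedDifferences

variable {Z : Type*} [MeasurableSpace Z]

lemma Measurable.integrable_of_abs_le {f : Z → ℝ} {μ : Measure Z} [IsFiniteMeasure μ]
    (hf : Measurable f) {C : ℝ} (hC : ∀ z, |f z| ≤ C) : Integrable f μ :=
  Integrable.of_bound hf.aestronglyMeasurable C (Filter.Eventually.of_forall hC)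

/-- Hoeffding's lemma: oscillation at most `c` places `m` in an interval of length `c` starting at
its infimum. -/
lemma integral_exp_mul_le_of_oscillation (D : Measure Z) [IsProbabilityMeasure D] {m : Z → ℝ}
    (hm : Measurable m) {c : ℝ} (hosc : ∀ z w, m z ≤ m w + c) (s : ℝ) :
    ∫ z, Real.exp (s * m z) ∂D ≤ Real.exp (s * ∫ z, m z ∂D + s ^ 2 * c ^ 2 / 8) := by
  have : Nonempty Z := nonempty_of_isProbabilityMeasure D
  obtain ⟨z₀⟩ := this
  have hbdd : BddBelow (Set.range m) := ⟨m z₀ - c, by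
    rintro _ ⟨z, rfl⟩
    linarith [hosc z₀ z]⟩
  have : Nonempty Z := ⟨z₀⟩
  have hIcc : ∀ z, m z ∈ Set.Icc (⨅ z, m z) ((⨅ z, m z) + c) := by
    refine fun z => ⟨ciInf_le hbdd z, ?_⟩
    have : m z - c ≤ ⨅ z, m z := le_ciInf fun w => by linarith [hosc z w]
    linarith
  have h := (ProbabilityTheory.hasSubgaussianMGF_of_mem_Icc (μ := D) hm.aemeasurable
    (Filter.Eventually.of_forall hIcc)).mgf_le s
  simp only [ProbabilityTheory.mgf, add_sub_cancel_left] at h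
  have e : ∀ z, Real.exp (s * (m z - ∫ z, m z ∂D))
      = Real.exp (s * m z) * Real.exp (-(s * ∫ z, m z ∂D)) := by
    intro z
    rw [← Real.exp_add]
    ring_nf
  simp only [e] at h
  rw [integral_mul_const, Real.exp_neg, ← div_eq_mul_inv, div_le_iff₀ (Real.exp_pos _),
    ← Real.exp_add] at h
  refine h.trans (Real.exp_le_exp.2 (le_of_eq ?_))
  simp only [NNReal.coe_pow, NNReal.coe_div, coe_nnnorm, Real.norm_eq_abs, div_pow, sq_abs,
    NNReal.coe_ofNat]
  ring

/-- The exponential-moment form of the bounded differences inequality. -/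
theorem integral_exp_mul_le_of_boundedDifferences (D : Measure Z) [IsProbabilityMeasure D]
    {c C : ℝ} (s : ℝ) : ∀ {n : ℕ} {f : (Fin n → Z) → ℝ}, Measurable f → (∀ z, |f z| ≤ C) →
    (∀ z i w, f (Function.update z i w) ≤ f z + c) →
    ∫ z, Real.exp (s * f z) ∂(Measure.pi fun _ : Fin n => D)
      ≤ Real.exp (s * ∫ z, f z ∂(Measure.pi fun _ : Fin n => D) + n * (s ^ 2 * c ^ 2 / 8)) := by
  intro n
  induction n with
  | zero =>
    intro f _ _ _
    have : ∀ z, f z = f default := fun z => congrArg f (Subsingleton.elim _ _)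
    simp only [this]
    simp
  | succ n ih =>
    intro f hf hC hc
    set Q : Measure (Fin n → Z) := Measure.pi fun _ : Fin n => D
    set F : Z × (Fin n → Z) → ℝ := fun p => f (Fin.cons p.1 p.2) with hF
    have hpres := (measurePreserving_piFinSuccAbove (fun _ : Fin (n + 1) => D) 0).symm
    have hFe : ∀ p, f ((MeasurableEquiv.piFinSuccAbove (fun _ => Z) 0).symm p) = F p := by
      intro p
      simp [hF, MeasurableEquiv.piFinSuccAbove, Fin.insertNthEquiv]
    have hFm : Measurable F := by
      have : F = f ∘ (MeasurableEquiv.piFinSuccAbove (fun _ => Z) 0).symm :=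
        funext fun p => (hFe p).symm
      rw [this]
      exact hf.comp (MeasurableEquiv.measurable _)
    have hFC : ∀ p, |F p| ≤ C := fun p => hC _
    have hexpm : Measurable fun p => Real.exp (s * F p) := by fun_prop
    have hexpC : ∀ p, |Real.exp (s * F p)| ≤ Real.exp (|s| * C) := by
      intro p
      rw [abs_of_pos (Real.exp_pos _)]
      refine Real.exp_le_exp.2 ((le_abs_self _).trans ?_)
      rw [abs_mul]
      exact mul_le_mul_of_nonneg_left (hFC p) (abs_nonneg s)
    have e1 : ∫ z, f z ∂(Measure.pi fun _ : Fin (n + 1) => D) = ∫ z, ∫ w, F (z, w) ∂Q ∂D := by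
      rw [← hpres.integral_comp', ← integral_prod _ (hFm.integrable_of_abs_le hFC)]
      exact integral_congr_ae (Filter.Eventually.of_forall hFe)
    have e2 : ∫ z, Real.exp (s * f z) ∂(Measure.pi fun _ : Fin (n + 1) => D)
        = ∫ z, ∫ w, Real.exp (s * F (z, w)) ∂Q ∂D := by
      rw [← hpres.integral_comp', ← integral_prod _ (hexpm.integrable_of_abs_le hexpC)]
      exact integral_congr_ae (Filter.Eventually.of_forall fun p => by
        simp only [hFe])
    rw [e1, e2]
    -- `m` is the conditional mean given the first coordinate. It has oscillation at most `c`, so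
    -- Hoeffding's lemma handles it and the induction hypothesis the remaining coordinates.
    set m : Z → ℝ := fun z => ∫ w, F (z, w) ∂Q with hmdef
    have hFz : ∀ z, Measurable fun w => F (z, w) := fun z => hFm.comp measurable_prodMk_left
    have hmm : Measurable m :=
      (hFm.stronglyMeasurable.integral_prod_right').measurable
    have hmC : ∀ z, |m z| ≤ C := by
      intro z
      have := norm_integral_le_of_norm_le_const (μ := Q) (f := fun w => F (z, w)) (C := C)
        (Filter.Eventually.of_forall fun w => hFC (z, w))
      simpa using this
    have hosc : ∀ z w, m z ≤ m w + c := by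
      intro z z'
      have : m z' + c = ∫ w, (F (z', w) + c) ∂Q := by
        rw [integral_add ((hFz z').integrable_of_abs_le fun w => hFC _) (integrable_const c)]
        simp [hmdef]
      rw [this]
      refine integral_mono ((hFz z).integrable_of_abs_le fun w => hFC _)
        (((hFz z').integrable_of_abs_le fun w => hFC _).add (integrable_const c)) fun w => ?_
      have := hc (Fin.cons z' w) 0 z
      rwa [Fin.update_cons_zero] at this
    have hin : ∀ z, ∫ w, Real.exp (s * F (z, w)) ∂Q
        ≤ Real.exp (s * m z) * Real.exp (n * (s ^ 2 * c ^ 2 / 8)) := by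
      intro z
      rw [← Real.exp_add]
      refine ih (hFz z) (fun w => hFC _) fun w i v => ?_
      have := hc (Fin.cons z w) i.succ v
      rwa [← Fin.cons_update] at this
    calc ∫ z, ∫ w, Real.exp (s * F (z, w)) ∂Q ∂D
        ≤ ∫ z, Real.exp (s * m z) * Real.exp (n * (s ^ 2 * c ^ 2 / 8)) ∂D := by
          refine integral_mono ?_ ?_ hin
          · exact (hexpm.integrable_of_abs_le (μ := D.prod Q) hexpC).integral_prod_left
          · refine Integrable.mul_const ?_ _
            refine Measurable.integrable_of_abs_le (C := Real.exp (|s| * C)) (by fun_prop) ?_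
            intro z
            rw [abs_of_pos (Real.exp_pos _)]
            refine Real.exp_le_exp.2 ((le_abs_self _).trans ?_)
            rw [abs_mul]
            exact mul_le_mul_of_nonneg_left (hmC z) (abs_nonneg s)
      _ ≤ Real.exp (s * ∫ z, m z ∂D + s ^ 2 * c ^ 2 / 8) * Real.exp (n * (s ^ 2 * c ^ 2 / 8)) := by
          rw [integral_mul_const]
          exact mul_le_mul_of_nonneg_right (integral_exp_mul_le_of_oscillation D hmm hosc s)
            (Real.exp_pos _).le
      _ = _ := by
          rw [← Real.exp_add]
          push_cast
          ring_nf

/-- McDiarmid's inequality. -/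
theorem measureReal_ge_le_of_boundedDifferences (D : Measure Z) [IsProbabilityMeasure D]
    {n : ℕ} (hn : 0 < n) {f : (Fin n → Z) → ℝ} (hf : Measurable f) {C : ℝ} (hC : ∀ z, |f z| ≤ C)
    (hc : ∀ z i w, f (Function.update z i w) ≤ f z + 1 / n) {t : ℝ} (ht : 0 ≤ t) :
    (Measure.pi fun _ : Fin n => D).real
        {z | (∫ z, f z ∂(Measure.pi fun _ : Fin n => D)) + t ≤ f z}
      ≤ Real.exp (-(2 * n * t ^ 2)) := by
  have hn' : (0 : ℝ) < n := Nat.cast_pos.2 hn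
  set Q := Measure.pi fun _ : Fin n => D
  have hint : Integrable (fun z => Real.exp (4 * n * t * f z)) Q := by
    refine Measurable.integrable_of_abs_le (C := Real.exp (4 * n * t * C)) (by fun_prop) ?_
    intro z
    rw [abs_of_pos (Real.exp_pos _)]
    gcongr
    exact (le_abs_self _).trans (hC z)
  -- The parameter `s = 4nt` minimizes the Chernoff exponent `-st + s²/(8n)`.
  have h1 := ProbabilityTheory.measure_ge_le_exp_mul_mgf (μ := Q) (X := f)
    ((∫ z, f z ∂Q) + t) (t := 4 * n * t) (by positivity) hint
  refine h1.trans ?_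
  have h2 := integral_exp_mul_le_of_boundedDifferences D (4 * n * t) hf hC hc
  refine (mul_le_mul_of_nonneg_left h2 (Real.exp_pos _).le).trans ?_
  rw [← Real.exp_add]
  refine Real.exp_le_exp.2 (le_of_eq ?_)
  field_simp
  ring

end BoundedDifferences

/-! ### Symmetrization and uniform deviation for finite families -/

section Symmetrization

variable {Z T : Type*} {n : ℕ}

/-- The largest one-sided deviation between the mean and the empirical mean over a family of
functions. -/
noncomputable def supDeviation [MeasurableSpace Z] (D : Measure Z) (ℓ : T → Z → ℝ) (S : Fin n → Z) : ℝ :=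
  ⨆ τ, (∫ z, ℓ τ z ∂D - 1 / n * ∑ i, ℓ τ (S i))

lemma abs_iSup_le_of_finite [Finite T] [Nonempty T] {f : T → ℝ} {C : ℝ} (h : ∀ τ, |f τ| ≤ C) : |⨆ τ, f τ| ≤ C := by
  obtain ⟨τ, hτ⟩ := exists_eq_ciSup_of_finite (f := f)
  rw [← hτ]
  exact h τ

lemma abs_sum_mul_le_card {a b : Fin n → ℝ} (ha : ∀ i, |a i| ≤ 1) (hb : ∀ i, |b i| ≤ 1) :
    |∑ i, a i * b i| ≤ n := by
  refine (Finset.abs_sum_le_sum_abs _ _).trans ?_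
  calc ∑ i, |a i * b i| ≤ ∑ _i : Fin n, (1 : ℝ) := Finset.sum_le_sum fun i _ => by
        rw [abs_mul]
        exact mul_le_one₀ (ha i) (abs_nonneg _) (hb i)
    _ = n := by simp

lemma abs_boolSign (b : Bool) : |boolSign b| = 1 := by
  cases b <;> simp [boolSign]

variable {ℓ : T → Z → ℝ}

lemma measurable_supDeviation [MeasurableSpace Z] [Finite T] (D : Measure Z) (hℓ : ∀ τ, Measurable (ℓ τ)) :
    Measurable (supDeviation (n := n) D ℓ) := by
  unfold supDeviation
  refine Measurable.iSup fun τ => ?_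
  have := hℓ τ
  fun_prop

/-- The supremum is subadditive, and negating all signs turns the subtracted half into another
Rademacher average. -/
lemma sum_iSup_sub_le [Finite T] [Nonempty T] {r : ℝ}
    (hr : ∀ S : Fin n → Z, ∑ σ : Fin n → Bool, ⨆ τ, ∑ i, boolSign (σ i) * ℓ τ (S i)
      ≤ Fintype.card (Fin n → Bool) * r) (p : Fin n → Z × Z) :
    ∑ σ : Fin n → Bool, ⨆ τ, ∑ i, boolSign (σ i) * (ℓ τ (p i).2 - ℓ τ (p i).1)
      ≤ Fintype.card (Fin n → Bool) * (2 * r) := by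
  have hneg : ∑ σ : Fin n → Bool, ⨆ τ, ∑ i, boolSign (!σ i) * ℓ τ (p i).1
      = ∑ σ : Fin n → Bool, ⨆ τ, ∑ i, boolSign (σ i) * ℓ τ (p i).1 :=
    Equiv.sum_comp (Equiv.piCongrRight fun _ : Fin n => Equiv.boolNot)
      (fun σ => ⨆ τ, ∑ i, boolSign (σ i) * ℓ τ (p i).1)
  have h1 := hr fun i => (p i).2
  have h2 := hr fun i => (p i).1
  rw [← hneg] at h2
  calc ∑ σ : Fin n → Bool, ⨆ τ, ∑ i, boolSign (σ i) * (ℓ τ (p i).2 - ℓ τ (p i).1)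
      ≤ ∑ σ : Fin n → Bool, ((⨆ τ, ∑ i, boolSign (σ i) * ℓ τ (p i).2)
          + ⨆ τ, ∑ i, boolSign (!σ i) * ℓ τ (p i).1) := by
        refine Finset.sum_le_sum fun σ _ => ciSup_le fun τ => ?_
        have e : ∑ i, boolSign (σ i) * (ℓ τ (p i).2 - ℓ τ (p i).1)
            = (∑ i, boolSign (σ i) * ℓ τ (p i).2) + ∑ i, boolSign (!σ i) * ℓ τ (p i).1 := by
          rw [← Finset.sum_add_distrib]
          refine Finset.sum_congr rfl fun i _ => ?_
          rw [boolSign_not]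
          ring
        rw [e]
        exact add_le_add
          (le_iSup_of_finite (fun τ => ∑ i, boolSign (σ i) * ℓ τ (p i).2) τ)
          (le_iSup_of_finite (fun τ => ∑ i, boolSign (!σ i) * ℓ τ (p i).1) τ)
    _ ≤ _ := by
        rw [Finset.sum_add_distrib]
        linarith

/-- Symmetrization: the expected one-sided deviation is at most twice the Rademacher average. -/
theorem integral_supDeviation_le [MeasurableSpace Z] [Finite T] [Nonempty T] (D : Measure Z)
    [IsProbabilityMeasure D] (hn : 0 < n)
    (hℓ : ∀ τ, Measurable (ℓ τ)) (h01 : ∀ τ z, ℓ τ z ∈ Set.Icc (0 : ℝ) 1) {r : ℝ}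
    (hr : ∀ S : Fin n → Z, ∑ σ : Fin n → Bool, ⨆ τ, ∑ i, boolSign (σ i) * ℓ τ (S i)
      ≤ Fintype.card (Fin n → Bool) * r) :
    ∫ S, supDeviation D ℓ S ∂(Measure.pi fun _ : Fin n => D) ≤ 1 / n * (2 * r) := by
  have hn' : (0 : ℝ) < n := Nat.cast_pos.2 hn
  set Q := Measure.pi fun _ : Fin n => D with hQ
  set W := Measure.pi fun _ : Fin n => D.prod D with hW
  have habs : ∀ τ z, |ℓ τ z| ≤ 1 := fun τ z => abs_le.2 ⟨by linarith [(h01 τ z).1], (h01 τ z).2⟩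
  have hdiff : ∀ τ z w, |ℓ τ z - ℓ τ w| ≤ 1 := fun τ z w => abs_le.2
    ⟨by linarith [(h01 τ z).1, (h01 τ w).2], by linarith [(h01 τ z).2, (h01 τ w).1]⟩
  have hmean : ∀ τ, ∫ S, (1 / n * ∑ i, ℓ τ (S i) : ℝ) ∂Q = ∫ z, ℓ τ z ∂D := by
    intro τ
    rw [integral_const_mul, integral_finsetSum]
    · have : ∀ i : Fin n, ∫ S, ℓ τ (S i) ∂Q = ∫ z, ℓ τ z ∂D := fun i =>
        integral_comp_eval (μ := fun _ : Fin n => D) (hℓ τ).aestronglyMeasurable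
      simp only [this, Finset.sum_const, Finset.card_univ, Fintype.card_fin, nsmul_eq_mul]
      field_simp
    · intro i _
      exact ((hℓ τ).comp (measurable_pi_apply i)).integrable_of_abs_le fun S => habs _ _
  set K : (Fin n → Bool) → (Fin n → Z × Z) → ℝ := fun σ p =>
    ⨆ τ, ∑ i, boolSign (σ i) * (ℓ τ (p i).2 - ℓ τ (p i).1) with hK
  have hKm : ∀ σ, Measurable (K σ) := by
    intro σ
    refine Measurable.iSup fun τ => Finset.measurable_sum _ fun i _ => ?_
    have := hℓ τ
    fun_prop
  have hKC : ∀ σ p, |K σ p| ≤ n := fun σ p => abs_iSup_le_of_finite fun τ =>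
    abs_sum_mul_le_card (fun i => (abs_boolSign _).le) fun i => hdiff _ _ _
  set G : (Fin n → Z) × (Fin n → Z) → ℝ := fun q =>
    ⨆ τ, ∑ i, (ℓ τ (q.2 i) - ℓ τ (q.1 i)) with hG
  have hGm : Measurable G := by
    refine Measurable.iSup fun τ => Finset.measurable_sum _ fun i _ => ?_
    have := hℓ τ
    fun_prop
  have hGC : ∀ q, |G q| ≤ n := fun q => abs_iSup_le_of_finite fun τ => by
    have := abs_sum_mul_le_card (n := n) (a := fun _ => 1)
      (b := fun i => ℓ τ (q.2 i) - ℓ τ (q.1 i)) (fun i => by simp) fun i => hdiff _ _ _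
    simpa using this
  have hGint : Integrable G (Q.prod Q) := hGm.integrable_of_abs_le hGC
  -- The mean is an integral over an independent ghost sample, and the supremum of integrals is at
  -- most the integral of the supremum.
  have step1 : ∫ S, supDeviation D ℓ S ∂Q ≤ 1 / n * ∫ q, G q ∂(Q.prod Q) := by
    rw [integral_prod _ hGint, ← integral_const_mul]
    refine integral_mono ?_ (hGint.integral_prod_left.const_mul _) fun S => ?_
    · refine (measurable_supDeviation D hℓ).integrable_of_abs_le (C := 1)
        fun S => abs_iSup_le_of_finite fun τ => ?_
      have h1 : ∫ z, ℓ τ z ∂D ∈ Set.Icc (0 : ℝ) 1 := by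
        refine ⟨integral_nonneg fun z => (h01 τ z).1, ?_⟩
        have := integral_mono ((hℓ τ).integrable_of_abs_le (μ := D) (habs τ))
          (integrable_const 1) (fun z => (h01 τ z).2)
        simpa using this
      have h2 : (1 / n * ∑ i, ℓ τ (S i) : ℝ) ∈ Set.Icc (0 : ℝ) 1 := by
        constructor
        · exact mul_nonneg (by positivity) (Finset.sum_nonneg fun i _ => (h01 τ _).1)
        · have : ∑ i, ℓ τ (S i) ≤ ∑ _i : Fin n, (1 : ℝ) :=
            Finset.sum_le_sum fun i _ => (h01 τ _).2
          rw [one_div, inv_mul_le_iff₀ hn']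
          simpa using this
      exact abs_le.2 ⟨by linarith [h1.1, h2.2], by linarith [h1.2, h2.1]⟩
    · refine ciSup_le fun τ => ?_
      have hi : Integrable (fun S' : Fin n → Z => (1 / n * ∑ i, ℓ τ (S' i) : ℝ)) Q :=
        Integrable.const_mul (integrable_finsetSum _ fun i _ =>
          ((hℓ τ).comp (measurable_pi_apply i)).integrable_of_abs_le fun S => habs _ _) _
      have e : ∫ z, ℓ τ z ∂D - 1 / n * ∑ i, ℓ τ (S i)
          = ∫ S', (1 / n * ∑ i, ℓ τ (S' i) - 1 / n * ∑ i, ℓ τ (S i) : ℝ) ∂Q := by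
        rw [integral_sub hi (integrable_const _), hmean]
        simp
      rw [e]
      simp only
      rw [← integral_const_mul]
      refine integral_mono (hi.sub (integrable_const _))
        (((hGm.comp measurable_prodMk_left).integrable_of_abs_le fun S' => hGC _).const_mul _)
        fun S' => ?_
      simp only
      rw [← mul_sub, ← Finset.sum_sub_distrib]
      exact mul_le_mul_of_nonneg_left
        (le_iSup_of_finite (fun τ => ∑ i, (ℓ τ (S' i) - ℓ τ (S i))) τ) (by positivity)
  have hpres := measurePreserving_arrowProdEquivProdArrow Z Z (Fin n) (fun _ => D) (fun _ => D)
  -- Swapping the two members of the `i`-th pair where `σ i` is false preserves the product measure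
  -- and puts the sign on that summand.
  have step2 : ∀ σ, ∫ q, G q ∂(Q.prod Q) = ∫ p, K σ p ∂W := by
    intro σ
    rw [← hpres.integral_comp']
    have hsw : ∀ i, MeasurePreserving (fun q : Z × Z => if σ i then q else q.swap)
        (D.prod D) (D.prod D) := by
      intro i
      by_cases h : σ i
      · simpa [h, Function.id_def] using MeasurePreserving.id (D.prod D)
      · simpa [h] using Measure.measurePreserving_swap
    have hpi := measurePreserving_pi (fun _ : Fin n => D.prod D) (fun _ => D.prod D) hsw
    have hcomp : Measurable fun p : Fin n → Z × Z =>
        G (MeasurableEquiv.arrowProdEquivProdArrow Z Z (Fin n) p) :=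
      hGm.comp (MeasurableEquiv.measurable _)
    have := integral_map (μ := W) hpi.measurable.aemeasurable
      (f := fun p => G (MeasurableEquiv.arrowProdEquivProdArrow Z Z (Fin n) p))
      hcomp.aestronglyMeasurable
    rw [hpi.map_eq] at this
    rw [this]
    refine integral_congr_ae (Filter.Eventually.of_forall fun p => ?_)
    simp only [hG, hK]
    congr 1
    funext τ
    refine Finset.sum_congr rfl fun i _ => ?_
    by_cases h : σ i <;>
      simp [h, boolSign, MeasurableEquiv.arrowProdEquivProdArrow, Equiv.arrowProdEquivProdArrow]
  have step3 : (Fintype.card (Fin n → Bool) : ℝ) * ∫ q, G q ∂(Q.prod Q)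
      ≤ Fintype.card (Fin n → Bool) * (2 * r) := by
    have e : (Fintype.card (Fin n → Bool) : ℝ) * ∫ q, G q ∂(Q.prod Q)
        = ∫ p, ∑ σ, K σ p ∂W := by
      rw [integral_finsetSum _ fun σ _ => (hKm σ).integrable_of_abs_le (hKC σ)]
      simp only [← step2, Finset.sum_const, Finset.card_univ, nsmul_eq_mul]
    rw [e]
    have := integral_mono (μ := W)
      (integrable_finsetSum _ fun σ _ => (hKm σ).integrable_of_abs_le (hKC σ))
      (integrable_const _) (sum_iSup_sub_le (ℓ := ℓ) hr)
    simpa using this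
  have hcard : (0 : ℝ) < Fintype.card (Fin n → Bool) := Nat.cast_pos.2 Fintype.card_pos
  exact step1.trans (mul_le_mul_of_nonneg_left (le_of_mul_le_mul_left step3 hcard) (by positivity))

/-- A uniform one-sided deviation inequality for a finite family of `[0, 1]`-valued functions in
terms of its Rademacher average. -/
theorem measureReal_exists_deviation_le [MeasurableSpace Z] [Finite T] [Nonempty T]
    (D : Measure Z) [IsProbabilityMeasure D] (hn : 0 < n)
    (hℓ : ∀ τ, Measurable (ℓ τ)) (h01 : ∀ τ z, ℓ τ z ∈ Set.Icc (0 : ℝ) 1) {r t : ℝ}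
    (hr : ∀ S : Fin n → Z, ∑ σ : Fin n → Bool, ⨆ τ, ∑ i, boolSign (σ i) * ℓ τ (S i)
      ≤ Fintype.card (Fin n → Bool) * r) (ht : 0 ≤ t) :
    (Measure.pi fun _ : Fin n => D).real
        {S | ∃ τ, 1 / n * (2 * r) + t < ∫ z, ℓ τ z ∂D - 1 / n * ∑ i, ℓ τ (S i)}
      ≤ Real.exp (-(2 * n * t ^ 2)) := by
  have hn' : (0 : ℝ) < n := Nat.cast_pos.2 hn
  have hE := integral_supDeviation_le D hn hℓ h01 hr
  obtain ⟨C, hC⟩ : ∃ C, ∀ S : Fin n → Z, |supDeviation D ℓ S| ≤ C := by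
    obtain ⟨C, hC⟩ := (Set.finite_range fun τ => |∫ z, ℓ τ z ∂D|).bddAbove
    refine ⟨C + 1 / n * n, fun S => abs_iSup_le_of_finite fun τ => ?_⟩
    refine (abs_sub _ _).trans (add_le_add (hC ⟨τ, rfl⟩) ?_)
    rw [abs_mul, abs_of_pos (by positivity : (0 : ℝ) < 1 / n)]
    refine mul_le_mul_of_nonneg_left ?_ (by positivity)
    have := abs_sum_mul_le_card (n := n) (a := fun _ => 1) (b := fun i => ℓ τ (S i))
      (fun i => by simp) fun i => abs_le.2 ⟨by linarith [(h01 τ (S i)).1], (h01 τ (S i)).2⟩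
    simpa using this
  have hbd : ∀ (S : Fin n → Z) i w,
      supDeviation D ℓ (Function.update S i w) ≤ supDeviation D ℓ S + 1 / n := by
    intro S i w
    refine ciSup_le fun τ => ?_
    have h1 := le_iSup_of_finite (fun τ => ∫ z, ℓ τ z ∂D - 1 / n * ∑ i, ℓ τ (S i)) τ
    have h2 : ∑ j, ℓ τ (S j) ≤ ∑ j, ℓ τ (Function.update S i w j) + 1 := by
      rw [← Finset.sum_erase_add _ _ (Finset.mem_univ i),
        ← Finset.sum_erase_add (f := fun j => ℓ τ (Function.update S i w j)) _ (Finset.mem_univ i)]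
      have : ∑ j ∈ Finset.univ.erase i, ℓ τ (Function.update S i w j)
          = ∑ j ∈ Finset.univ.erase i, ℓ τ (S j) := Finset.sum_congr rfl fun j hj => by
        rw [Function.update_of_ne (Finset.ne_of_mem_erase hj)]
      rw [this, Function.update_self]
      linarith [(h01 τ (S i)).2, (h01 τ w).1]
    have h3 := mul_le_mul_of_nonneg_left h2 (by positivity : (0 : ℝ) ≤ 1 / n)
    unfold supDeviation
    linarith
  refine le_trans ?_ (measureReal_ge_le_of_boundedDifferences D hn (measurable_supDeviation D hℓ)
    hC hbd ht)
  refine measureReal_mono ?_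
  rintro S ⟨τ, hτ⟩
  have h1 := le_iSup_of_finite (fun τ => ∫ z, ℓ τ z ∂D - 1 / n * ∑ i, ℓ τ (S i)) τ
  have h2 : supDeviation D ℓ S = ⨆ τ, (∫ z, ℓ τ z ∂D - 1 / n * ∑ i, ℓ τ (S i)) := rfl
  change (∫ S, supDeviation D ℓ S ∂(Measure.pi fun _ : Fin n => D)) + t ≤ supDeviation D ℓ S
  linarith

end Symmetrization

/-! ### The frequency class and the decision functions inside it -/

/-- Continuous functions whose finite linear combinations of values on the ball of radius `R` are
controlled by the centred exponentials with frequencies of norm at most `r`. -/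
def frequencyClass (E : Type*) [NormedAddCommGroup E] [InnerProductSpace ℝ E] (r R Λ : ℝ) :
    Set C(E, ℝ) :=
  {g | ∀ (n : ℕ) (a : Fin n → ℝ) (x : Fin n → E) (M : ℝ), 0 ≤ M → (∀ i, ‖x i‖ ≤ R) →
    (∀ ω : E, ‖ω‖ ≤ r → ‖∑ i, (a i : ℂ)
      * (Complex.exp (Complex.I * (inner ℝ ω (x i) : ℝ)) - 1)‖ ≤ r * R * M) →
    |∑ i, a i * g (x i)| ≤ Λ * M}

section FrequencyClass

variable {E : Type*} [NormedAddCommGroup E] [InnerProductSpace ℝ E] {r R Λ : ℝ}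

lemma frequencyClass_mono {Λ' : ℝ} (h : Λ ≤ Λ') :
    frequencyClass E r R Λ ⊆ frequencyClass E r R Λ' := fun _ hg n a x M hM hx hω =>
  (hg n a x M hM hx hω).trans (mul_le_mul_of_nonneg_right h hM)

lemma zero_mem_frequencyClass (hΛ : 0 ≤ Λ) : (0 : C(E, ℝ)) ∈ frequencyClass E r R Λ := by
  intro n a x M hM _ _
  simpa using mul_nonneg hΛ hM

/-- A single point with `M = 1` is an admissible test, as `‖exp(it) - 1‖ ≤ |t| ≤ rR`. -/
lemma abs_apply_le_of_mem_frequencyClass {g : C(E, ℝ)} (hg : g ∈ frequencyClass E r R Λ)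
    {x : E} (hx : ‖x‖ ≤ R) : |g x| ≤ Λ := by
  have hR : 0 ≤ R := (norm_nonneg x).trans hx
  have := hg 1 (fun _ => 1) (fun _ => x) 1 zero_le_one (fun _ => hx) (fun ω hω => by
    have hr : 0 ≤ r := (norm_nonneg ω).trans hω
    have h1 : ‖Complex.exp (Complex.I * (inner ℝ ω x : ℝ)) - 1‖ ≤ ‖(inner ℝ ω x : ℝ)‖ :=
      Real.norm_exp_I_mul_ofReal_sub_one_le
    have h2 : ‖(inner ℝ ω x : ℝ)‖ ≤ r * R := (norm_inner_le_norm ω x).trans (by gcongr)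
    simpa using h1.trans h2)
  simpa using this

end FrequencyClass

section DecisionFunction

variable {d n : ℕ} {k : EuclideanSpace ℝ (Fin d) → EuclideanSpace ℝ (Fin d) → ℝ}
  {lam : Measure (EuclideanSpace ℝ (Fin d))} {x : Fin n → EuclideanSpace ℝ (Fin d)}
  {f : EuclideanSpace ℝ (Fin d) → ℝ}

lemma norm_exp_I_mul_inner (ω z : EuclideanSpace ℝ (Fin d)) :
    ‖Complex.exp (Complex.I * (inner ℝ ω z : ℝ))‖ = 1 := by
  rw [mul_comm]
  exact Complex.norm_exp_ofReal_mul_I _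

/-- A normalized decision function is an integral of exponentials against an `L²`-normalized
weight. -/
lemma IsSVMDecisionFunction.exists_weight (hk : IsDualMeasure k lam)
    (hf : IsSVMDecisionFunction k x f) :
    ∃ h : EuclideanSpace ℝ (Fin d) → ℂ, Continuous h ∧ (∃ C, ∀ ω, ‖h ω‖ ≤ C) ∧
      (∀ z, (f z : ℂ) = ∫ ω, Complex.exp (Complex.I * (inner ℝ ω z : ℝ)) * h ω ∂lam) ∧
      ∫ ω, ‖h ω‖ ^ 2 ∂lam ≤ 1 := by
  have := hk.finite
  obtain ⟨α, hα, hfα⟩ := hf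
  set h : EuclideanSpace ℝ (Fin d) → ℂ := fun ω =>
    ∑ j, (α j : ℂ) * Complex.exp (-(Complex.I * (inner ℝ ω (x j) : ℝ))) with hh
  have hcont : Continuous h := by fun_prop
  have hn1 : ∀ ω j, ‖Complex.exp (-(Complex.I * (inner ℝ ω (x j) : ℝ)))‖ = 1 := by
    intro ω j
    rw [Complex.exp_neg, norm_inv, norm_exp_I_mul_inner, inv_one]
  have hbound : ∀ ω, ‖h ω‖ ≤ ∑ j, |α j| := by
    intro ω
    refine (norm_sum_le _ _).trans (Finset.sum_le_sum fun j _ => ?_)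
    rw [norm_mul, hn1, mul_one, Complex.norm_real, Real.norm_eq_abs]
  have hrep : ∀ z, (f z : ℂ) = ∫ ω, Complex.exp (Complex.I * (inner ℝ ω z : ℝ)) * h ω ∂lam := by
    intro z
    rw [hfα]
    push_cast
    simp only [hk.eq_integral, hh, Finset.mul_sum]
    rw [integral_finsetSum]
    · refine Finset.sum_congr rfl fun j _ => ?_
      rw [← integral_const_mul]
      refine integral_congr_ae (Filter.Eventually.of_forall fun ω => ?_)
      simp only
      rw [mul_left_comm, ← Complex.exp_add, inner_sub_right]
      push_cast
      ring_nf
    · intro j _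
      refine Integrable.of_bound (C := |α j|) ?_ (Filter.Eventually.of_forall fun ω => ?_)
      · exact Continuous.aestronglyMeasurable (by fun_prop)
      · rw [norm_mul, norm_mul, hn1, norm_exp_I_mul_inner, Complex.norm_real, Real.norm_eq_abs]
        simp
  refine ⟨h, hcont, ⟨_, hbound⟩, hrep, ?_⟩
  -- The quadratic form equals `∑ α_i f(x_i)`; inserting the representation of `f` produces `conj h
  -- * h` under the integral.
  have hq : ((α ⬝ᵥ (gramMatrix k x *ᵥ α) : ℝ) : ℂ) = ∫ ω, ((‖h ω‖ ^ 2 : ℝ) : ℂ) ∂lam := by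
    have e1 : α ⬝ᵥ (gramMatrix k x *ᵥ α) = ∑ i, α i * f (x i) := by
      simp only [dotProduct, Matrix.mulVec, gramMatrix, Matrix.of_apply, hfα]
      refine Finset.sum_congr rfl fun i _ => ?_
      congr 1
      exact Finset.sum_congr rfl fun j _ => mul_comm _ _
    rw [e1]
    push_cast
    simp only [hrep]
    simp only [← integral_const_mul]
    rw [← integral_finsetSum]
    · refine integral_congr_ae (Filter.Eventually.of_forall fun ω => ?_)
      simp only
      rw [← Complex.conj_mul', ← Finset.sum_congr rfl fun i _ => mul_assoc _ _ _, ← Finset.sum_mul]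
      congr 1
      simp only [hh, map_sum, map_mul, Complex.conj_ofReal, ← Complex.exp_conj, map_neg,
        Complex.conj_I]
      exact Finset.sum_congr rfl fun i _ => by ring_nf
    · intro i _
      refine Integrable.of_bound (C := |α i| * ∑ j, |α j|) ?_
        (Filter.Eventually.of_forall fun ω => ?_)
      · exact Continuous.aestronglyMeasurable (by fun_prop)
      · rw [norm_mul, norm_mul, norm_exp_I_mul_inner, Complex.norm_real, Real.norm_eq_abs, one_mul]
        exact mul_le_mul_of_nonneg_left (hbound ω) (abs_nonneg _)
  rw [integral_complex_ofReal] at hq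
  rw [← Complex.ofReal_injective hq]
  exact hα

/-- Cauchy–Schwarz, obtained by integrating the pointwise inequality `(√q‖h‖ - 1)² ≥ 0`; for `q = 0`
the measure vanishes. -/
lemma integral_norm_le_sqrt {h : EuclideanSpace ℝ (Fin d) → ℂ} [IsFiniteMeasure lam]
    (hc : Continuous h) (hb : ∃ C, ∀ ω, ‖h ω‖ ≤ C) (h2 : ∫ ω, ‖h ω‖ ^ 2 ∂lam ≤ 1) {q : ℝ}
    (hq : lam.real Set.univ ≤ q) : ∫ ω, ‖h ω‖ ∂lam ≤ √q := by
  obtain ⟨C, hC⟩ := hb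
  have hq0 : 0 ≤ q := measureReal_nonneg.trans hq
  rcases hq0.eq_or_lt with rfl | hpos
  · have : lam = 0 := by
      have h0 : lam.real Set.univ = 0 := le_antisymm hq measureReal_nonneg
      rwa [measureReal_eq_zero_iff, Measure.measure_univ_eq_zero] at h0
    simp [this]
  have hs : 0 < √q := Real.sqrt_pos.2 hpos
  have hi2 : Integrable (fun ω => ‖h ω‖ ^ 2) lam := by
    refine Measurable.integrable_of_abs_le (C := C ^ 2) (by fun_prop) fun ω => ?_
    rw [abs_of_nonneg (by positivity)]
    exact pow_le_pow_left₀ (norm_nonneg _) (hC ω) 2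
  have hi1 : Integrable (fun ω => ‖h ω‖) lam :=
    Measurable.integrable_of_abs_le (C := C) (by fun_prop) fun ω => by simpa using hC ω
  calc ∫ ω, ‖h ω‖ ∂lam ≤ ∫ ω, (√q / 2 * ‖h ω‖ ^ 2 + 1 / (2 * √q)) ∂lam := by
        refine integral_mono hi1 ((hi2.const_mul _).add (integrable_const _)) fun ω => ?_
        have : √q / 2 * ‖h ω‖ ^ 2 + 1 / (2 * √q) - ‖h ω‖
            = (√q * ‖h ω‖ - 1) ^ 2 / (2 * √q) := by
          field_simp
          ring
        have h' : 0 ≤ (√q * ‖h ω‖ - 1) ^ 2 / (2 * √q) := by positivity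
        simp only
        linarith
    _ = √q / 2 * ∫ ω, ‖h ω‖ ^ 2 ∂lam + lam.real Set.univ * (1 / (2 * √q)) := by
        rw [integral_add (hi2.const_mul _) (integrable_const _), integral_const_mul,
          integral_const, smul_eq_mul]
    _ ≤ √q / 2 * 1 + q * (1 / (2 * √q)) := by gcongr
    _ = √q := by
        nth_rewrite 2 [← Real.mul_self_sqrt hq0]
        field_simp
        ring

/-- The centred and rescaled decision functions lie in a frequency class. -/
lemma IsSVMDecisionFunction.exists_mem_frequencyClass (hk : IsDualMeasure k lam)
    (hf : IsSVMDecisionFunction k x f) {r R q θ : ℝ} (hr : 0 ≤ r) (hR : 0 ≤ R) (hθ : 0 < θ)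
    (hq : lam.real Set.univ ≤ q) (hsupp : lam {ω | r < ‖ω‖} = 0) :
    ∃ g ∈ frequencyClass (EuclideanSpace ℝ (Fin d)) r R (√q * r * R / θ),
      ∀ z, f z = θ * (f 0 / θ + g z) := by
  have := hk.finite
  obtain ⟨h, hc, ⟨C, hC⟩, hrep, h2⟩ := hf.exists_weight hk
  have hint : ∀ z : EuclideanSpace ℝ (Fin d),
      Integrable (fun ω => Complex.exp (Complex.I * (inner ℝ ω z : ℝ)) * h ω) lam := by
    intro z
    refine Integrable.of_bound (C := C) (Continuous.aestronglyMeasurable (by fun_prop))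
      (Filter.Eventually.of_forall fun ω => ?_)
    rw [norm_mul, norm_exp_I_mul_inner, one_mul]
    exact hC ω
  have hfc : Continuous f := by
    have : Continuous fun z => (f z : ℂ) := by
      simp only [hrep]
      refine continuous_of_dominated (bound := fun _ => C)
        (fun z => (hint z).aestronglyMeasurable)
        (fun z => Filter.Eventually.of_forall fun ω => ?_) (integrable_const _)
        (Filter.Eventually.of_forall fun ω => by fun_prop)
      rw [norm_mul, norm_exp_I_mul_inner, one_mul]
      exact hC ω
    exact Complex.continuous_re.comp this
  -- Subtracting `f 0` is what replaces `exp(i⟨ω,z⟩)` by the centred exponential.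
  refine ⟨⟨fun z => (f z - f 0) / θ, by fun_prop⟩, ?_, fun z => ?_⟩
  · intro m a y M hM hy hω
    have e : ((∑ i, a i * ((f (y i) - f 0) / θ) : ℝ) : ℂ) * θ
        = ∫ ω, (∑ i, (a i : ℂ) * (Complex.exp (Complex.I * (inner ℝ ω (y i) : ℝ)) - 1))
          * h ω ∂lam := by
      push_cast
      rw [Finset.sum_mul]
      simp only [Finset.sum_mul]
      rw [integral_finsetSum]
      · refine Finset.sum_congr rfl fun i _ => ?_
        have : ∀ ω, (a i : ℂ) * (Complex.exp (Complex.I * (inner ℝ ω (y i) : ℝ)) - 1) * h ω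
            = a i * (Complex.exp (Complex.I * (inner ℝ ω (y i) : ℝ)) * h ω
              - Complex.exp (Complex.I * (inner ℝ ω (0 : EuclideanSpace ℝ (Fin d)) : ℝ)) * h ω) := by
          intro ω
          simp
          ring
        simp only [this]
        rw [integral_const_mul, integral_sub (hint _) (hint _), ← hrep, ← hrep]
        have hθ' : (θ : ℂ) ≠ 0 := by exact_mod_cast hθ.ne'
        field_simp
      · intro i _
        have : ∀ ω, (a i : ℂ) * (Complex.exp (Complex.I * (inner ℝ ω (y i) : ℝ)) - 1) * h ω
            = a i * (Complex.exp (Complex.I * (inner ℝ ω (y i) : ℝ)) * h ω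
              - Complex.exp (Complex.I * (inner ℝ ω (0 : EuclideanSpace ℝ (Fin d)) : ℝ)) * h ω) := by
          intro ω
          simp
          ring
        simp only [this]
        exact ((hint _).sub (hint _)).const_mul _
    have hi1 : Integrable (fun ω => ‖h ω‖) lam :=
      Measurable.integrable_of_abs_le (C := C) (by fun_prop) fun ω => by simpa using hC ω
    have hae : ∀ᵐ ω ∂lam, ‖ω‖ ≤ r := by
      rw [ae_iff]
      simpa using hsupp
    have hb : |∑ i, a i * ((f (y i) - f 0) / θ)| * θ ≤ r * R * M * √q := by
      calc |∑ i, a i * ((f (y i) - f 0) / θ)| * θ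
          = ‖((∑ i, a i * ((f (y i) - f 0) / θ) : ℝ) : ℂ) * θ‖ := by
            rw [norm_mul, Complex.norm_real, Complex.norm_real, Real.norm_eq_abs,
              Real.norm_of_nonneg hθ.le]
        _ ≤ ∫ ω, r * R * M * ‖h ω‖ ∂lam := by
            rw [e]
            refine norm_integral_le_of_norm_le (hi1.const_mul _) ?_
            filter_upwards [hae] with ω hω'
            rw [norm_mul]
            exact mul_le_mul_of_nonneg_right (hω ω hω') (norm_nonneg _)
        _ ≤ r * R * M * √q := by
            rw [integral_const_mul]
            exact mul_le_mul_of_nonneg_left (integral_norm_le_sqrt hc ⟨C, hC⟩ h2 hq)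
              (by positivity)
    change |∑ i, a i * ((f (y i) - f 0) / θ)| ≤ _
    rw [← le_div_iff₀ hθ] at hb
    refine hb.trans (le_of_eq ?_)
    ring
  · change f z = θ * (f 0 / θ + (f z - f 0) / θ)
    field_simp
    ring

end DecisionFunction

/-! ### The ramp and the grid of offsets -/

/-- A ramp of slope `-5/4` that equals `1` up to `1/10` and `0` from `9/10` on. -/
noncomputable def ramp (t : ℝ) : ℝ := max 0 (min 1 (5 / 4 * (9 / 10 - t)))

lemma ramp_mem_Icc (t : ℝ) : ramp t ∈ Set.Icc (0 : ℝ) 1 :=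
  ⟨le_max_left _ _, max_le zero_le_one (min_le_left _ _)⟩

lemma continuous_ramp : Continuous ramp := by
  unfold ramp
  fun_prop

lemma ramp_eq_one {t : ℝ} (h : t ≤ 1 / 10) : ramp t = 1 := by
  unfold ramp
  rw [min_eq_left (by linarith), max_eq_right zero_le_one]

lemma ramp_eq_zero {t : ℝ} (h : 9 / 10 ≤ t) : ramp t = 0 := by
  unfold ramp
  exact max_eq_left ((min_le_right _ _).trans (by linarith))

lemma abs_ramp_sub_le (s t : ℝ) : |ramp s - ramp t| ≤ 5 / 4 * |s - t| := by
  have h1 := abs_max_sub_max_le_abs (min (5 / 4 * (9 / 10 - s)) 1) (min (5 / 4 * (9 / 10 - t)) 1) 0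
  have h2 : |min (5 / 4 * (9 / 10 - s)) 1 - min (5 / 4 * (9 / 10 - t)) 1|
      ≤ |5 / 4 * (9 / 10 - s) - 5 / 4 * (9 / 10 - t)| := abs_inf_sub_inf_le_abs _ _ _
  unfold ramp
  rw [max_comm 0, max_comm 0, min_comm 1, min_comm 1]
  refine (h1.trans h2).trans (le_of_eq ?_)
  rw [show 5 / 4 * (9 / 10 - s) - 5 / 4 * (9 / 10 - t) = -(5 / 4 * (s - t)) by ring, abs_neg,
    abs_mul, abs_of_pos (by norm_num : (0 : ℝ) < 5 / 4)]

/-- The offset of a margin function may be rounded to a bounded grid at the price of replacing the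
indicator of nonpositive margin by the ramp. -/
lemma exists_grid_offset (c : ℝ) {Λ : ℝ} (hΛ : 0 ≤ Λ) :
    ∃ m : ℤ, |(m : ℝ)| ≤ 11 / 2 + 5 * Λ ∧ ∀ v, |v| ≤ Λ → ∀ y : ℝ, (y = 1 ∨ y = -1) →
      (y * (c + v) ≤ 0 → ramp (y * (m / 5 + v)) = 1) ∧
      (1 < y * (c + v) → ramp (y * (m / 5 + v)) = 0) := by
  have hround : ∀ a : ℝ, |a - round a| ≤ 1 / 2 := fun a => abs_sub_round a
  -- Outside `[-(1+Λ), 1+Λ]` the sign of `c + v` is the same for all admissible `v`, so `c` may be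
  -- clamped to the nearer endpoint. This bounds the grid index by `5(1 + Λ) + 1/2`.
  rcases le_total c (-(1 + Λ)) with hc | hc
  · refine ⟨round (5 * -(1 + Λ)), ?_, ?_⟩
    all_goals
      have hm := abs_le.1 (hround (5 * -(1 + Λ)))
      set m := round (5 * -(1 + Λ))
    · exact abs_le.2 ⟨by linarith [hm.1, hm.2], by linarith [hm.1, hm.2]⟩
    · intro v hv y hy
      have hv' := abs_le.1 hv
      rcases hy with rfl | rfl
      · exact ⟨fun _ => ramp_eq_one (by linarith [hm.1, hm.2, hv'.2]),
          fun h => absurd h (by linarith [hv'.2])⟩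
      · exact ⟨fun h => absurd h (by linarith [hv'.2]),
          fun _ => ramp_eq_zero (by linarith [hm.1, hm.2, hv'.2])⟩
  rcases le_total (1 + Λ) c with hc' | hc'
  · refine ⟨round (5 * (1 + Λ)), ?_, ?_⟩
    all_goals
      have hm := abs_le.1 (hround (5 * (1 + Λ)))
      set m := round (5 * (1 + Λ))
    · exact abs_le.2 ⟨by linarith [hm.1, hm.2], by linarith [hm.1, hm.2]⟩
    · intro v hv y hy
      have hv' := abs_le.1 hv
      rcases hy with rfl | rfl
      · exact ⟨fun h => absurd h (by linarith [hv'.1]),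
          fun _ => ramp_eq_zero (by linarith [hm.1, hm.2, hv'.1])⟩
      · exact ⟨fun _ => ramp_eq_one (by linarith [hm.1, hm.2, hv'.1]),
          fun h => absurd h (by linarith [hv'.1])⟩
  -- Rounding `5c` moves the offset by at most 1/10, exactly the slack of the ramp at each end of
  -- `[0, 1]`.
  · refine ⟨round (5 * c), ?_, ?_⟩
    all_goals
      have hm := abs_le.1 (hround (5 * c))
      set m := round (5 * c)
    · exact abs_le.2 ⟨by linarith [hm.1, hm.2], by linarith [hm.1, hm.2]⟩
    · intro v hv y hy
      rcases hy with rfl | rfl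
      · exact ⟨fun _ => ramp_eq_one (by linarith [hm.1, hm.2]),
          fun h => ramp_eq_zero (by linarith [hm.1, hm.2])⟩
      · exact ⟨fun _ => ramp_eq_one (by linarith [hm.1, hm.2]),
          fun h => ramp_eq_zero (by linarith [hm.1, hm.2])⟩

/-! ### Uniform deviation of ramp losses over a frequency class -/

section RampLoss

variable {E : Type*} [NormedAddCommGroup E]

/-- Labelled points of norm at most `R` with label `±1`. -/
def labelledBall (E : Type*) [NormedAddCommGroup E] (R : ℝ) : Set (E × ℝ) :=
  {z | ‖z.1‖ ≤ R ∧ (z.2 = 1 ∨ z.2 = -1)}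

/-- The ramp loss of the margin function `c + g`, restricted to `labelledBall E R`. -/
noncomputable def rampLoss (R c : ℝ) (g : C(E, ℝ)) : E × ℝ → ℝ :=
  (labelledBall E R).indicator fun z => ramp (z.2 * (c + g z.1))

lemma rampLoss_mem_Icc (R c : ℝ) (g : C(E, ℝ)) (z : E × ℝ) :
    rampLoss R c g z ∈ Set.Icc (0 : ℝ) 1 := by
  unfold rampLoss
  by_cases h : z ∈ labelledBall E R
  · rw [Set.indicator_of_mem h]
    exact ramp_mem_Icc _
  · rw [Set.indicator_of_notMem h]
    exact ⟨le_rfl, zero_le_one⟩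

lemma measurableSet_labelledBall [MeasurableSpace E] [OpensMeasurableSpace E] (R : ℝ) :
    MeasurableSet (labelledBall E R) := by
  have h1 : MeasurableSet {z : E × ℝ | ‖z.1‖ ≤ R} :=
    measurableSet_le measurable_fst.norm measurable_const
  have h2 : MeasurableSet {z : E × ℝ | z.2 = 1 ∨ z.2 = -1} :=
    (measurableSet_eq_fun measurable_snd measurable_const).union
      (measurableSet_eq_fun measurable_snd measurable_const)
  exact h1.inter h2

lemma measurable_rampLoss [MeasurableSpace E] [BorelSpace E] (R c : ℝ) (g : C(E, ℝ)) :
    Measurable (rampLoss R c g) := by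
  refine Measurable.indicator ?_ (measurableSet_labelledBall R)
  exact continuous_ramp.measurable.comp
    (measurable_snd.mul (measurable_const.add (g.continuous.measurable.comp measurable_fst)))

variable [InnerProductSpace ℝ E]

/-- The Rademacher average of the ramp losses over a finite subset of a frequency class. -/
lemma sum_iSup_rampLoss_le [ProperSpace E] {T : Type*} [Finite T] [Nonempty T] {n : ℕ}
    {r R Λ : ℝ} (hr : 0 ≤ r) (hR : 0 ≤ R) (hΛ : 0 ≤ Λ) (c : ℝ) {g : T → C(E, ℝ)}
    (hg : ∀ τ, g τ ∈ frequencyClass E r R Λ) (S : Fin n → E × ℝ) :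
    ∑ σ : Fin n → Bool, ⨆ τ, ∑ i, boolSign (σ i) * rampLoss R c (g τ) (S i)
      ≤ Fintype.card (Fin n → Bool) * (5 / 2 * Λ * √n) := by
  classical
  -- The loss vanishes off the labelled ball, so such points may be moved to 0 to keep all norms at
  -- most `R`.
  set x : Fin n → E := fun i => if S i ∈ labelledBall E R then (S i).1 else 0 with hxdef
  have hx : ∀ i, ‖x i‖ ≤ R := by
    intro i
    by_cases h : S i ∈ labelledBall E R
    · simpa [hxdef, h] using h.1
    · simpa [hxdef, h] using hR
  obtain ⟨M', hM0, hMω, hMsum⟩ := exists_bound_exp_sub_one x hr hR hx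
  rw [Fintype.card_fin] at hMsum
  have hcard : (0 : ℝ) < Fintype.card (Fin n → Bool) := Nat.cast_pos.2 Fintype.card_pos
  obtain ⟨M, hM, hMω', hMsum'⟩ : ∃ M : (Fin n → Bool) → ℝ, (∀ σ, 0 ≤ M σ) ∧
      (∀ σ, M' σ ≤ r * R * M σ) ∧ ∑ σ, M σ ≤ Fintype.card (Fin n → Bool) * (2 * √n) := by
    -- If `r * R = 0`, the bound on the sum forces `M' = 0`, so `M = 0` is admissible and no
    -- division is needed.
    rcases (mul_nonneg hr hR).eq_or_lt with h0 | hpos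
    · refine ⟨0, fun σ => le_rfl, fun σ => ?_, by simp⟩
      rw [← h0] at hMsum ⊢
      have h1 := Finset.single_le_sum (f := M') (fun σ _ => hM0 σ) (Finset.mem_univ σ)
      simp only [mul_zero, zero_mul] at hMsum ⊢
      linarith
    · refine ⟨fun σ => M' σ / (r * R), fun σ => div_nonneg (hM0 σ) hpos.le, fun σ => ?_, ?_⟩
      · rw [mul_div_cancel₀ _ hpos.ne']
      · rw [← Finset.sum_div, div_le_iff₀ hpos]
        refine hMsum.trans (le_of_eq (by ring))
  -- Subtracting the loss of `g = 0` makes contraction applicable, and this baseline has Rademacher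
  -- average zero.
  set b : Fin n → ℝ := fun i => rampLoss R c 0 (S i) with hb
  set w : T → Fin n → ℝ := fun τ i => rampLoss R c (g τ) (S i) - b i with hw
  set v : T → Fin n → ℝ := fun τ i => 5 / 4 * g τ (x i) with hv
  have hdiff : ∀ (g₁ g₂ : C(E, ℝ)) i, |rampLoss R c g₁ (S i) - rampLoss R c g₂ (S i)|
      ≤ 5 / 4 * |g₁ (x i) - g₂ (x i)| := by
    intro g₁ g₂ i
    unfold rampLoss
    by_cases h : S i ∈ labelledBall E R
    · rw [Set.indicator_of_mem h, Set.indicator_of_mem h]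
      refine (abs_ramp_sub_le _ _).trans (le_of_eq ?_)
      have hy : |(S i).2| = 1 := by rcases h.2 with h' | h' <;> simp [h']
      rw [← mul_sub, abs_mul, hy, one_mul, add_sub_add_left_eq_sub]
      simp [hxdef, h]
    · rw [Set.indicator_of_notMem h, Set.indicator_of_notMem h]
      simp only [sub_self, abs_zero]
      positivity
  have hvd : ∀ τ τ' i, |v τ i - v τ' i| = 5 / 4 * |g τ (x i) - g τ' (x i)| := by
    intro τ τ' i
    rw [hv, ← mul_sub, abs_mul, abs_of_pos (by norm_num : (0 : ℝ) < 5 / 4)]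
  have hcontr := (convexOn_id (𝕜 := ℝ) convex_univ).sum_iSup_contraction monotone_id v w
    (fun τ i => by
      have := hdiff (g τ) 0 i
      rw [hv, abs_mul, abs_of_pos (by norm_num : (0 : ℝ) < 5 / 4)]
      simpa using this)
    (fun τ τ' i => by
      rw [hvd, hw, sub_sub_sub_cancel_right]
      exact hdiff _ _ i)
  simp only [id] at hcontr
  have hsplit : ∀ σ : Fin n → Bool, ⨆ τ, ∑ i, boolSign (σ i) * rampLoss R c (g τ) (S i)
      ≤ (⨆ τ, ∑ i, boolSign (σ i) * w τ i) + ∑ i, boolSign (σ i) * b i := by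
    intro σ
    refine ciSup_le fun τ => ?_
    have h1 := le_iSup_of_finite (fun τ => ∑ i, boolSign (σ i) * w τ i) τ
    have h2 : ∑ i, boolSign (σ i) * rampLoss R c (g τ) (S i)
        = ∑ i, boolSign (σ i) * w τ i + ∑ i, boolSign (σ i) * b i := by
      rw [← Finset.sum_add_distrib]
      exact Finset.sum_congr rfl fun i _ => by rw [hw]; ring
    linarith
  have hbase : ∑ σ : Fin n → Bool, ∑ i, boolSign (σ i) * b i = 0 := by
    rw [Finset.sum_comm]
    refine Finset.sum_eq_zero fun i _ => ?_
    rw [← Finset.sum_mul, sum_boolSign, zero_mul]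
  calc ∑ σ : Fin n → Bool, ⨆ τ, ∑ i, boolSign (σ i) * rampLoss R c (g τ) (S i)
      ≤ ∑ σ : Fin n → Bool, ((⨆ τ, ∑ i, boolSign (σ i) * w τ i) + ∑ i, boolSign (σ i) * b i) :=
        Finset.sum_le_sum fun σ _ => hsplit σ
    _ = ∑ σ : Fin n → Bool, ⨆ τ, ∑ i, boolSign (σ i) * w τ i := by
        rw [Finset.sum_add_distrib, hbase, add_zero]
    _ ≤ ∑ σ : Fin n → Bool, ⨆ τ, ∑ i, boolSign (σ i) * v τ i := hcontr
    _ ≤ ∑ σ : Fin n → Bool, 5 / 4 * Λ * M σ := by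
        refine Finset.sum_le_sum fun σ _ => ciSup_le fun τ => ?_
        have h1 := hg τ n (fun i => boolSign (σ i)) x (M σ) (hM σ) hx
          (fun ω hω => (hMω σ ω hω).trans (hMω' σ))
        have h2 : ∑ i, boolSign (σ i) * v τ i = 5 / 4 * ∑ i, boolSign (σ i) * g τ (x i) := by
          rw [Finset.mul_sum]
          exact Finset.sum_congr rfl fun i _ => by rw [hv]; ring
        rw [h2, mul_assoc]
        exact mul_le_mul_of_nonneg_left ((le_abs_self _).trans h1) (by norm_num)
    _ ≤ _ := by
        rw [← Finset.mul_sum]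
        refine (mul_le_mul_of_nonneg_left hMsum' (by positivity)).trans (le_of_eq (by ring))

variable [MeasurableSpace E] [BorelSpace E]

/-- Uniform deviation for the ramp losses over a countable subset of a frequency class. -/
lemma measure_exists_rampLoss_deviation_le [ProperSpace E] (D : Measure (E × ℝ))
    [IsProbabilityMeasure D] {n : ℕ} (hn : 0 < n) {r R Λ t : ℝ} (hr : 0 ≤ r) (hR : 0 ≤ R)
    (hΛ : 0 ≤ Λ) (c : ℝ) {g : ℕ → C(E, ℝ)} (hg : ∀ k, g k ∈ frequencyClass E r R Λ)
    (ht : 0 ≤ t) :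
    (Measure.pi fun _ : Fin n => D) {S | ∃ k, 5 * Λ / √n + t <
        ∫ z, rampLoss R c (g k) z ∂D - 1 / n * ∑ i, rampLoss R c (g k) (S i)}
      ≤ ENNReal.ofReal (Real.exp (-(2 * n * t ^ 2))) := by
  have hn' : (0 : ℝ) < n := Nat.cast_pos.2 hn
  -- The finite-family bound does not depend on the number of functions, so continuity from below
  -- extends it to the sequence.
  set A : ℕ → Set (Fin n → E × ℝ) := fun N => {S | ∃ k : Fin (N + 1), 5 * Λ / √n + t <
    ∫ z, rampLoss R c (g k) z ∂D - 1 / n * ∑ i, rampLoss R c (g k) (S i)} with hA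
  have hmono : Monotone A := by
    rintro N N' hNN' S ⟨k, hk⟩
    exact ⟨⟨k, by omega⟩, hk⟩
  have hU : {S : Fin n → E × ℝ | ∃ k, 5 * Λ / √n + t <
      ∫ z, rampLoss R c (g k) z ∂D - 1 / n * ∑ i, rampLoss R c (g k) (S i)} = ⋃ N, A N := by
    ext S
    simp only [Set.mem_iUnion]
    exact ⟨fun ⟨k, hk⟩ => ⟨k, ⟨k, by omega⟩, hk⟩, fun ⟨N, k, hk⟩ => ⟨k, hk⟩⟩
  rw [hU, hmono.measure_iUnion]
  refine iSup_le fun N => ?_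
  have h := measureReal_exists_deviation_le (ℓ := fun k : Fin (N + 1) => rampLoss R c (g k)) D hn
    (fun k => measurable_rampLoss R c _) (fun k z => rampLoss_mem_Icc R c _ z)
    (fun S => sum_iSup_rampLoss_le hr hR hΛ c (fun k : Fin (N + 1) => hg k) S) ht
  have e : 1 / (n : ℝ) * (2 * (5 / 2 * Λ * √n)) = 5 * Λ / √n := by
    have hs : √(n : ℝ) ≠ 0 := (Real.sqrt_pos.2 hn').ne'
    have hs2 : (n : ℝ) = √n * √n := (Real.mul_self_sqrt hn'.le).symm
    rw [div_mul_eq_mul_div, div_eq_div_iff hn'.ne' hs]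
    linear_combination -5 * Λ * hs2
  rw [e] at h
  rw [← ofReal_measureReal]
  exact ENNReal.ofReal_le_ofReal h

/-- Uniform deviation for the ramp losses over a frequency class. -/
theorem exists_measurableSet_rampLoss_deviation [FiniteDimensional ℝ E] (D : Measure (E × ℝ))
    [IsProbabilityMeasure D] {n : ℕ} (hn : 0 < n) {r R Λ t : ℝ} (hr : 0 ≤ r) (hR : 0 ≤ R)
    (hΛ : 0 ≤ Λ) (c : ℝ) (ht : 0 ≤ t) :
    ∃ A : Set (Fin n → E × ℝ), MeasurableSet A ∧
      (Measure.pi fun _ : Fin n => D) Aᶜ ≤ ENNReal.ofReal (Real.exp (-(2 * n * t ^ 2))) ∧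
      ∀ S ∈ A, ∀ g ∈ frequencyClass E r R Λ,
        ∫ z, rampLoss R c g z ∂D - 1 / n * ∑ i, rampLoss R c g (S i) ≤ 5 * Λ / √n + t := by
  have : ProperSpace E := FiniteDimensional.proper_real E
  have : Nonempty (frequencyClass E r R Λ) := ⟨⟨0, zero_mem_frequencyClass hΛ⟩⟩
  -- A sequence dense in the class makes the failure event a countable union; dominated convergence
  -- then extends the bound to the whole class.
  set g : ℕ → C(E, ℝ) := fun k =>
    (TopologicalSpace.denseSeq (frequencyClass E r R Λ) k : C(E, ℝ)) with hgdef
  have hg : ∀ k, g k ∈ frequencyClass E r R Λ := fun k => Subtype.coe_prop _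
  refine ⟨{S | ∃ k, 5 * Λ / √n + t <
    ∫ z, rampLoss R c (g k) z ∂D - 1 / n * ∑ i, rampLoss R c (g k) (S i)}ᶜ, ?_, ?_, ?_⟩
  · refine MeasurableSet.compl ?_
    have : {S : Fin n → E × ℝ | ∃ k, 5 * Λ / √n + t <
        ∫ z, rampLoss R c (g k) z ∂D - 1 / n * ∑ i, rampLoss R c (g k) (S i)}
        = ⋃ k, {S | 5 * Λ / √n + t <
        ∫ z, rampLoss R c (g k) z ∂D - 1 / n * ∑ i, rampLoss R c (g k) (S i)} := by
      ext S
      simp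
    rw [this]
    refine MeasurableSet.iUnion fun k => measurableSet_lt measurable_const ?_
    have := measurable_rampLoss R c (g k)
    fun_prop
  · rw [compl_compl]
    exact measure_exists_rampLoss_deviation_le D hn hr hR hΛ c hg ht
  · intro S hS h hh
    have hS' : ∀ k, ∫ z, rampLoss R c (g k) z ∂D - 1 / n * ∑ i, rampLoss R c (g k) (S i)
        ≤ 5 * Λ / √n + t := fun k => not_lt.1 fun hk => hS ⟨k, hk⟩
    obtain ⟨u, hu, hlim⟩ := mem_closure_iff_seq_limit.1
      ((TopologicalSpace.denseRange_denseSeq (frequencyClass E r R Λ)) ⟨h, hh⟩)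
    have hlim' : ∀ z, Filter.Tendsto (fun k => rampLoss R c (u k : C(E, ℝ)) z) Filter.atTop
        (nhds (rampLoss R c h z)) := by
      intro z
      unfold rampLoss
      by_cases hz : z ∈ labelledBall E R
      · simp only [Set.indicator_of_mem hz]
        refine (continuous_ramp.tendsto _).comp (Filter.Tendsto.const_mul _
          (Filter.Tendsto.const_add _ ?_))
        have hc : Continuous fun φ : frequencyClass E r R Λ => (φ : C(E, ℝ)) z.1 := by fun_prop
        exact (hc.tendsto _).comp hlim
      · simp only [Set.indicator_of_notMem hz]
        exact tendsto_const_nhds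
    have hI : Filter.Tendsto (fun k => ∫ z, rampLoss R c (u k : C(E, ℝ)) z ∂D) Filter.atTop
        (nhds (∫ z, rampLoss R c h z ∂D)) := by
      refine tendsto_integral_of_dominated_convergence (fun _ => 1)
        (fun k => (measurable_rampLoss R c _).aestronglyMeasurable) (integrable_const _)
        (fun k => Filter.Eventually.of_forall fun z => ?_)
        (Filter.Eventually.of_forall hlim')
      rw [Real.norm_of_nonneg (rampLoss_mem_Icc R c _ z).1]
      exact (rampLoss_mem_Icc R c _ z).2
    have hA := hI.sub ((tendsto_finsetSum Finset.univ fun i _ => hlim' (S i)).const_mul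
      (1 / (n : ℝ)))
    refine le_of_tendsto hA (Filter.Eventually.of_forall fun k => ?_)
    obtain ⟨l, hl⟩ := hu k
    have := hS' l
    simp only [hgdef, hl] at this
    exact this

end RampLoss

/-! ### A deterministic substitute for the data radius -/

section Quantile

variable {Z : Type*} [MeasurableSpace Z]

/-- Existence of an upper quantile of a nonnegative random variable. -/
lemma exists_upper_quantile (D : Measure Z) [IsProbabilityMeasure D] {N : Z → ℝ}
    (hN : Measurable N) (hN0 : ∀ z, 0 ≤ N z) {η : ENNReal} (hη0 : 0 < η) (hη1 : η ≤ 1) :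
    ∃ R : ℝ, 0 ≤ R ∧ D {z | R < N z} ≤ η ∧ η ≤ D {z | R ≤ N z} := by
  have hms : ∀ ρ : ℝ, MeasurableSet {z | ρ < N z} := fun ρ => measurableSet_lt measurable_const hN
  set s : Set ℝ := {ρ | 0 ≤ ρ ∧ D {z | ρ < N z} ≤ η} with hs
  have hne : s.Nonempty := by
    have hanti : Antitone fun k : ℕ => {z | (k : ℝ) < N z} := by
      intro a b hab z hz
      have h : (b : ℝ) < N z := hz
      have hab' : (a : ℝ) ≤ b := by exact_mod_cast hab
      exact lt_of_le_of_lt hab' h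
    have hlim := tendsto_measure_iInter_atTop (μ := D)
      (fun k : ℕ => (hms k).nullMeasurableSet) hanti ⟨0, measure_ne_top _ _⟩
    have hempty : ⋂ k : ℕ, {z | (k : ℝ) < N z} = ∅ := by
      ext z
      obtain ⟨k, hk⟩ := exists_nat_ge (N z)
      simp only [Set.mem_iInter, Set.mem_empty_iff_false, iff_false]
      exact fun h => absurd (h k) (not_lt.2 hk)
    rw [hempty, measure_empty] at hlim
    obtain ⟨k, hk⟩ := (hlim.eventually (gt_mem_nhds hη0)).exists
    exact ⟨k, Nat.cast_nonneg k, le_of_lt hk⟩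
  have hbdd : BddBelow s := ⟨0, fun ρ hρ => hρ.1⟩
  have hR0 : 0 ≤ sInf s := le_csInf hne fun ρ hρ => hρ.1
  refine ⟨sInf s, hR0, ?_, ?_⟩
  · have hU : {z | sInf s < N z} = ⋃ k : ℕ, {z | sInf s + 1 / ((k : ℝ) + 1) < N z} := by
      ext z
      simp only [Set.mem_iUnion]
      constructor
      · intro hz
        have hz' : sInf s < N z := hz
        obtain ⟨k, hk⟩ := exists_nat_one_div_lt (sub_pos.2 hz')
        refine ⟨k, ?_⟩
        change sInf s + 1 / ((k : ℝ) + 1) < N z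
        linarith
      · rintro ⟨k, hk⟩
        have hk' : sInf s + 1 / ((k : ℝ) + 1) < N z := hk
        have : (0 : ℝ) < 1 / ((k : ℝ) + 1) := by positivity
        change sInf s < N z
        linarith
    have hmono : Monotone fun k : ℕ => {z | sInf s + 1 / ((k : ℝ) + 1) < N z} := by
      intro a b hab z hz
      have h : sInf s + 1 / ((a : ℝ) + 1) < N z := hz
      have h' : 1 / ((b : ℝ) + 1) ≤ 1 / ((a : ℝ) + 1) := by gcongr
      change sInf s + 1 / ((b : ℝ) + 1) < N z
      linarith
    rw [hU, hmono.measure_iUnion]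
    refine iSup_le fun k => ?_
    obtain ⟨ρ, hρ, hlt⟩ := exists_lt_of_csInf_lt hne
      (lt_add_of_pos_right (sInf s) (by positivity : (0 : ℝ) < 1 / ((k : ℝ) + 1)))
    exact (measure_mono fun z hz => lt_trans hlt hz).trans hρ.2
  · rcases hR0.eq_or_lt with h0 | hpos
    · rw [← h0]
      have : {z | 0 ≤ N z} = Set.univ := Set.eq_univ_of_forall hN0
      rw [this, measure_univ]
      exact hη1
    -- The decrement is proportional to `sInf s`, so the approximating radii stay nonnegative, as
    -- membership in `s` requires.
    · have hI : {z | sInf s ≤ N z} = ⋂ k : ℕ, {z | sInf s - sInf s / ((k : ℝ) + 1) < N z} := by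
        ext z
        simp only [Set.mem_iInter]
        constructor
        · intro hz k
          have hz' : sInf s ≤ N z := hz
          have : 0 < sInf s / ((k : ℝ) + 1) := by positivity
          change sInf s - sInf s / ((k : ℝ) + 1) < N z
          linarith
        · intro h
          change sInf s ≤ N z
          refine le_of_forall_pos_lt_add fun ε hε => ?_
          obtain ⟨k, hk⟩ := exists_nat_one_div_lt (div_pos hε hpos)
          have h1 : sInf s - sInf s / ((k : ℝ) + 1) < N z := h k
          rw [lt_div_iff₀ hpos, div_mul_eq_mul_div, one_mul] at hk
          linarith
      have hanti : Antitone fun k : ℕ => {z | sInf s - sInf s / ((k : ℝ) + 1) < N z} := by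
        intro a b hab z hz
        have h : sInf s - sInf s / ((b : ℝ) + 1) < N z := hz
        have h' : sInf s / ((b : ℝ) + 1) ≤ sInf s / ((a : ℝ) + 1) := by gcongr
        change sInf s - sInf s / ((a : ℝ) + 1) < N z
        linarith
      rw [hI, hanti.measure_iInter (fun k => (hms _).nullMeasurableSet) ⟨0, measure_ne_top _ _⟩]
      refine le_iInf fun k => ?_
      by_contra hlt
      have hmem : sInf s - sInf s / ((k : ℝ) + 1) ∈ s := by
        refine ⟨?_, (not_le.1 hlt).le⟩
        have : sInf s / ((k : ℝ) + 1) ≤ sInf s := div_le_self hpos.le (by simp)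
        linarith
      have := csInf_le hbdd hmem
      have : 0 < sInf s / ((k : ℝ) + 1) := by positivity
      linarith

/-- Independence gives an `n`-th power, and `1 - η ≤ exp(-η)`. -/
lemma measure_pi_forall_lt_le (D : Measure Z) [IsProbabilityMeasure D] {n : ℕ} {N : Z → ℝ}
    (hN : Measurable N) {R η : ℝ} (hη : 0 ≤ η) (hR : ENNReal.ofReal η ≤ D {z | R ≤ N z}) :
    (Measure.pi fun _ : Fin n => D) {S | ∀ i, N (S i) < R}
      ≤ ENNReal.ofReal (Real.exp (-(n * η))) := by
  have hset : {S : Fin n → Z | ∀ i, N (S i) < R} = Set.univ.pi fun _ => {z | N z < R} := by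
    ext S
    simp
  have hcompl : {z | N z < R} = {z | R ≤ N z}ᶜ := by
    ext z
    simp
  have hD : D {z | N z < R} ≤ ENNReal.ofReal (Real.exp (-η)) := by
    rw [hcompl, prob_compl_eq_one_sub (measurableSet_le measurable_const hN)]
    calc 1 - D {z | R ≤ N z} ≤ 1 - ENNReal.ofReal η := tsub_le_tsub_left hR 1
      _ = ENNReal.ofReal (1 - η) := by rw [ENNReal.ofReal_sub _ hη, ENNReal.ofReal_one]
      _ ≤ _ := ENNReal.ofReal_le_ofReal (by linarith [Real.add_one_le_exp (-η)])
  rw [hset, Measure.pi_pi, Finset.prod_const, Finset.card_univ, Fintype.card_fin]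
  refine (pow_le_pow_left' hD n).trans (le_of_eq ?_)
  rw [← ENNReal.ofReal_pow (Real.exp_pos _).le, ← Real.exp_nat_mul, mul_neg]

end Quantile

/-! ### Summing the failure probabilities -/

section UnionBound

/-- In the expanded square `2(15/8)² > 7`, while the cross term is `(3/4)√L(j+1) ≥ (j+1)/2` because
`√L ≥ 4/5`. -/
lemma exp_neg_sq_le {L : ℝ} (hL : 4 / 5 ≤ √L) (hL0 : 0 ≤ L) (j : ℕ) :
    Real.exp (-(2 * (15 / 8 * √L + (j + 1) / 10) ^ 2))
      ≤ Real.exp (-(7 * L)) * (2 / 3) ^ (j + 1) := by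
  have h1 : Real.exp (-(1 / 2)) ≤ 2 / 3 := by
    rw [Real.exp_neg, inv_le_comm₀ (Real.exp_pos _) (by norm_num)]
    linarith [Real.add_one_le_exp (1 / 2)]
  have h2 : Real.exp (-(((j + 1 : ℕ) : ℝ) * (1 / 2))) ≤ (2 / 3) ^ (j + 1) := by
    rw [← mul_neg, Real.exp_nat_mul]
    exact pow_le_pow_left₀ (Real.exp_pos _).le h1 _
  refine le_trans ?_ (mul_le_mul_of_nonneg_left h2 (Real.exp_pos _).le)
  rw [← Real.exp_add]
  refine Real.exp_le_exp.2 ?_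
  have hs : √L ^ 2 = L := Real.sq_sqrt hL0
  have hj : (0 : ℝ) ≤ j := Nat.cast_nonneg j
  push_cast
  nlinarith [mul_nonneg hj (sub_nonneg.2 hL)]

/-- Here `15 + 2j` is the number of offsets at scale `j`. Bernoulli's inequality for `(9/8)^(j+1)`
absorbs it, since `3/4 = (9/8)(2/3)`. -/
lemma card_mul_two_thirds_pow_le (j : ℕ) :
    (15 + 2 * j : ℝ) * (2 / 3) ^ (j + 1) ≤ 16 * (3 / 4) ^ (j + 1) := by
  have hb := one_add_mul_le_pow (by norm_num : (-2 : ℝ) ≤ 1 / 8) (j + 1)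
  push_cast at hb
  have : (3 / 4 : ℝ) ^ (j + 1) = (1 + 1 / 8) ^ (j + 1) * (2 / 3) ^ (j + 1) := by
    rw [← mul_pow]
    norm_num
  rw [this, ← mul_assoc]
  refine mul_le_mul_of_nonneg_right ?_ (by positivity)
  linarith

/-- The failure probabilities of the grid sum up to at most half of the confidence level. -/
lemma tsum_grid_failure_le {L : ℝ} (hL : Real.log 2 ≤ L) (hL' : 4 / 5 ≤ √L) :
    ∑' j : ℕ, ∑ _m ∈ Finset.Icc (-(7 + j : ℤ)) (7 + j),
      ENNReal.ofReal (Real.exp (-(2 * (15 / 8 * √L + (j + 1) / 10) ^ 2)))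
      ≤ ENNReal.ofReal (Real.exp (-L)) := by
  have hL0 : 0 ≤ L := (Real.log_nonneg (by norm_num)).trans hL
  have hterm : ∀ j : ℕ, ∑ _m ∈ Finset.Icc (-(7 + j : ℤ)) (7 + j),
      ENNReal.ofReal (Real.exp (-(2 * (15 / 8 * √L + (j + 1) / 10) ^ 2)))
      ≤ ENNReal.ofReal (Real.exp (-L) * (1 / 4 * (3 / 4) ^ (j + 1))) := by
    intro j
    have hcard : (Finset.Icc (-(7 + j : ℤ)) (7 + j)).card = 15 + 2 * j := by
      rw [Int.card_Icc]
      omega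
    rw [Finset.sum_const, hcard, nsmul_eq_mul, ← ENNReal.ofReal_natCast,
      ← ENNReal.ofReal_mul (Nat.cast_nonneg _)]
    refine ENNReal.ofReal_le_ofReal ?_
    -- `L ≥ log 2` gives `exp(-6L) ≤ 1/64`, which beats the factor 16 from the offset count.
    have h64 : Real.exp (-(7 * L)) ≤ Real.exp (-L) * (1 / 64) := by
      have h2 : Real.exp (-L) ≤ 1 / 2 := by
        rw [Real.exp_neg, one_div]
        refine inv_anti₀ (by norm_num) ?_
        rw [← Real.exp_log (by norm_num : (0 : ℝ) < 2)]
        exact Real.exp_le_exp.2 hL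
      have h6 := pow_le_pow_left₀ (Real.exp_pos _).le h2 6
      have e : Real.exp (-(7 * L)) = Real.exp (-L) * Real.exp (-L) ^ 6 := by
        rw [← Real.exp_nat_mul, ← Real.exp_add]
        push_cast
        ring_nf
      rw [e]
      exact mul_le_mul_of_nonneg_left (h6.trans (by norm_num)) (Real.exp_pos _).le
    push_cast
    calc (15 + 2 * j : ℝ) * Real.exp (-(2 * (15 / 8 * √L + (j + 1) / 10) ^ 2))
        ≤ (15 + 2 * j) * (Real.exp (-L) * (1 / 64) * (2 / 3) ^ (j + 1)) := by
          refine mul_le_mul_of_nonneg_left ((exp_neg_sq_le hL' hL0 j).trans ?_) (by positivity)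
          exact mul_le_mul_of_nonneg_right h64 (by positivity)
      _ = Real.exp (-L) * (1 / 64) * ((15 + 2 * j) * (2 / 3) ^ (j + 1)) := by ring
      _ ≤ Real.exp (-L) * (1 / 64) * (16 * (3 / 4) ^ (j + 1)) :=
          mul_le_mul_of_nonneg_left (card_mul_two_thirds_pow_le j) (by positivity)
      _ = _ := by ring
  refine (ENNReal.tsum_le_tsum hterm).trans ?_
  have hgeo : HasSum (fun j : ℕ => Real.exp (-L) * (1 / 4 * (3 / 4 : ℝ) ^ (j + 1)))
      (Real.exp (-L) * (3 / 4)) := by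
    have h := (hasSum_geometric_of_lt_one (r := (3 / 4 : ℝ)) (by norm_num) (by norm_num)).mul_left
      (Real.exp (-L) * (1 / 4 * (3 / 4)))
    have e1 : Real.exp (-L) * (1 / 4 * (3 / 4)) * (1 - 3 / 4 : ℝ)⁻¹ = Real.exp (-L) * (3 / 4) := by
      rw [mul_assoc]
      norm_num
    have e2 : (fun j : ℕ => Real.exp (-L) * (1 / 4 * (3 / 4)) * (3 / 4 : ℝ) ^ j)
        = fun j : ℕ => Real.exp (-L) * (1 / 4 * (3 / 4 : ℝ) ^ (j + 1)) := by
      funext j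
      ring
    rwa [e1, e2] at h
  rw [← ENNReal.ofReal_tsum_of_nonneg (fun j => by positivity) hgeo.summable, hgeo.tsum_eq]
  exact ENNReal.ofReal_le_ofReal (by nlinarith [Real.exp_pos (-L)])

end UnionBound

/-! ### From ramp loss to margin error, and the main theorem -/

section Margin

variable {d n : ℕ}

lemma empiricalMarginError_nonneg {X : Type*} (S : Fin n → X × ℝ) (f : X → ℝ) (θ : ℝ) :
    0 ≤ empiricalMarginError S f θ :=
  mul_nonneg (by positivity)
    (Finset.sum_nonneg fun i _ => Set.indicator_nonneg (fun _ _ => zero_le_one) _)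

lemma dataNorm_nonneg (S : Fin n → EuclideanSpace ℝ (Fin d) × ℝ) : 0 ≤ dataNorm S :=
  Real.iSup_nonneg fun i => norm_nonneg (S i).1

/-- Passage from the ramp-loss deviation to the margin bound for a single function. -/
lemma measureReal_le_of_rampLoss_deviation {E : Type*} [NormedAddCommGroup E] [MeasurableSpace E]
    [BorelSpace E] (D : Measure (E × ℝ)) [IsProbabilityMeasure D] (S : Fin n → E × ℝ)
    {R c Λ θ B : ℝ} {m : ℤ} (hθ : 0 < θ) {f : E → ℝ} {g : C(E, ℝ)}
    (hfg : ∀ z, f z = θ * (c + g z)) (hgΛ : ∀ z, ‖z‖ ≤ R → |g z| ≤ Λ)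
    (hm : ∀ v, |v| ≤ Λ → ∀ y : ℝ, (y = 1 ∨ y = -1) →
      (y * (c + v) ≤ 0 → ramp (y * (m / 5 + v)) = 1) ∧
      (1 < y * (c + v) → ramp (y * (m / 5 + v)) = 0))
    (hdev : ∫ z, rampLoss R (m / 5) g z ∂D - 1 / n * ∑ i, rampLoss R (m / 5) g (S i) ≤ B) :
    D.real {z | z.2 * f z.1 ≤ 0}
      ≤ empiricalMarginError S f θ + B + D.real (labelledBall E R)ᶜ := by
  have hmul : ∀ z : E × ℝ, z.2 * f z.1 = θ * (z.2 * (c + g z.1)) := fun z => by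
    rw [hfg]
    ring
  have hfm : Measurable f := by
    have : f = fun z => θ * (c + g z) := funext hfg
    rw [this]
    exact measurable_const.mul (measurable_const.add g.continuous.measurable)
  have hmeas : MeasurableSet {z : E × ℝ | z.2 * f z.1 ≤ 0} :=
    measurableSet_le (measurable_snd.mul (hfm.comp measurable_fst)) measurable_const
  have hB := measurableSet_labelledBall (E := E) R
  have h1 : D.real {z | z.2 * f z.1 ≤ 0}
      ≤ D.real ({z | z.2 * f z.1 ≤ 0} ∩ labelledBall E R) + D.real (labelledBall E R)ᶜ := by
    refine (measureReal_mono ?_).trans (measureReal_union_le _ _)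
    intro z hz
    by_cases h : z ∈ labelledBall E R
    · exact Or.inl ⟨hz, h⟩
    · exact Or.inr h
  have h2 : D.real ({z | z.2 * f z.1 ≤ 0} ∩ labelledBall E R)
      ≤ ∫ z, rampLoss R (m / 5) g z ∂D := by
    rw [← integral_indicator_one (hmeas.inter hB)]
    refine integral_mono ((integrable_const (1 : ℝ)).indicator (hmeas.inter hB))
      ((measurable_rampLoss R _ g).integrable_of_abs_le (C := 1) fun z => ?_) fun z => ?_
    · exact abs_le.2 ⟨by linarith [(rampLoss_mem_Icc R (m / 5) g z).1],
        (rampLoss_mem_Icc R (m / 5) g z).2⟩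
    · refine Set.indicator_le' (fun z hz => ?_) (fun z _ => (rampLoss_mem_Icc R _ g z).1) z
      have hz1 : z.2 * f z.1 ≤ 0 := hz.1
      rw [hmul, ← mul_zero θ, mul_le_mul_iff_right₀ hθ] at hz1
      unfold rampLoss
      rw [Set.indicator_of_mem hz.2, (hm _ (hgΛ _ hz.2.1) _ hz.2.2).1 hz1]
      rfl
  have h3 : 1 / n * ∑ i, rampLoss R (m / 5) g (S i) ≤ empiricalMarginError S f θ := by
    refine mul_le_mul_of_nonneg_left (Finset.sum_le_sum fun i _ => ?_) (by positivity)
    by_cases hi : S i ∈ {z : E × ℝ | z.2 * f z.1 ≤ θ}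
    · rw [Set.indicator_of_mem hi]
      exact (rampLoss_mem_Icc R _ g (S i)).2
    · rw [Set.indicator_of_notMem hi]
      have hi' : θ < (S i).2 * f (S i).1 := not_le.1 hi
      rw [hmul] at hi'
      have hi'' : 1 < (S i).2 * (c + g (S i).1) := lt_of_mul_lt_mul_left (by linarith) hθ.le
      unfold rampLoss
      by_cases hb : S i ∈ labelledBall E R
      · rw [Set.indicator_of_mem hb, (hm _ (hgΛ _ hb.1) _ hb.2).2 hi'']
      · rw [Set.indicator_of_notMem hb]
  linarith

end Margin

theorem mainTheorem3 {d n : ℕ} (hn : 0 < n) (Rω Rlam : ℝ) (hRω : 0 ≤ Rω)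
    (D : Measure (EuclideanSpace ℝ (Fin d) × ℝ)) [IsProbabilityMeasure D]
    (hD : ∀ᵐ z ∂D, z.2 = 1 ∨ z.2 = -1)
    (δ : ℝ) (hδ0 : 0 < δ) (hδ1 : δ < 1) :
    ∃ good : Set (Fin n → EuclideanSpace ℝ (Fin d) × ℝ),
      MeasurableSet good ∧
      ENNReal.ofReal (1 - δ) ≤ (Measure.pi fun _ : Fin n => D) good ∧
      ∀ S ∈ good,
        ∀ (k : EuclideanSpace ℝ (Fin d) → EuclideanSpace ℝ (Fin d) → ℝ)
          (lam : Measure (EuclideanSpace ℝ (Fin d))),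
          IsDualMeasure k lam → lam.real Set.univ ≤ Rlam → lam {ω | Rω < ‖ω‖} = 0 →
          ∀ f : EuclideanSpace ℝ (Fin d) → ℝ,
            IsSVMDecisionFunction k (fun i => (S i).1) f →
            ∀ θ : ℝ, 0 < θ →
              D.real {z | z.2 * f z.1 ≤ 0} ≤
                empiricalMarginError S f θ
                  + 6 * Rω * dataNorm S / θ * Real.sqrt (Rlam / n)
                  + 3 * Real.sqrt (Real.log (2 / δ) / n) := by
  have hn' : (0 : ℝ) < n := Nat.cast_pos.2 hn
  have hsn : 0 < √(n : ℝ) := Real.sqrt_pos.2 hn'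
  set L := Real.log (2 / δ) with hLdef
  have hexpL : Real.exp (-L) = δ / 2 := by
    rw [hLdef, ← Real.log_inv, Real.exp_log (by positivity), inv_div]
  have hL2 : Real.log 2 ≤ L := Real.log_le_log (by norm_num) (by
    rw [le_div_iff₀ hδ0]
    linarith)
  have hLpos : 0 < L := (Real.log_pos (by norm_num)).trans_le hL2
  have hsL : 4 / 5 ≤ √L := by
    refine Real.le_sqrt_of_sq_le ?_
    linarith [Real.log_two_gt_d9]
  have hsqrtdiv : √(L / n) = √L / √n := Real.sqrt_div hLpos.le _
  -- For `n ≤ 9L` the last term is at least 1 and the bound is trivial. Otherwise `η = L/n ≤ 1/9`,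
  -- so that `η ≤ √η / 3`.
  rcases le_or_gt (n : ℝ) (9 * L) with hbig | hsmall
  · refine ⟨Set.univ, MeasurableSet.univ, ?_, ?_⟩
    · rw [measure_univ, ← ENNReal.ofReal_one]
      exact ENNReal.ofReal_le_ofReal (by linarith)
    · intro S _ k lam _ _ _ f _ θ hθ
      have h1 : D.real {z | z.2 * f z.1 ≤ 0} ≤ 1 := measureReal_le_one
      have h2 := empiricalMarginError_nonneg S f θ
      have h3 : 0 ≤ 6 * Rω * dataNorm S / θ * √(Rlam / n) := by
        have := dataNorm_nonneg S
        positivity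
      have h4 : 1 / 3 ≤ √(L / n) := by
        refine Real.le_sqrt_of_sq_le ?_
        rw [le_div_iff₀ hn']
        linarith
      linarith
  set η : ℝ := L / n with hη
  have hη0 : 0 < η := div_pos hLpos hn'
  have hη9 : η ≤ 1 / 9 := by
    rw [hη, div_le_iff₀ hn']
    linarith
  have hηsqrt : η ≤ 1 / 3 * √η := by
    have h1 : √η ≤ 1 / 3 := by
      rw [Real.sqrt_le_left (by norm_num)]
      linarith
    nlinarith [Real.mul_self_sqrt hη0.le, Real.sqrt_nonneg η]
  have hNm : Measurable fun z : EuclideanSpace ℝ (Fin d) × ℝ => ‖z.1‖ := measurable_fst.norm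
  obtain ⟨R, hR0, hRgt, hRge⟩ := exists_upper_quantile D hNm (fun z => norm_nonneg _)
    (η := ENNReal.ofReal η) (ENNReal.ofReal_pos.2 hη0) (by
      rw [← ENNReal.ofReal_one]
      exact ENNReal.ofReal_le_ofReal (by linarith))
  have hBc : D.real (labelledBall (EuclideanSpace ℝ (Fin d)) R)ᶜ ≤ η := by
    refine ENNReal.toReal_le_of_le_ofReal hη0.le (le_trans ?_ hRgt)
    refine measure_mono_ae ?_
    filter_upwards [hD] with z hz hzc
    exact not_le.1 fun h => hzc ⟨h, hz⟩
  have ht0 : ∀ j : ℕ, 0 ≤ (15 / 8 * √L + (j + 1) / 10) / √n := fun j => by positivity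
  -- One event for each scale `(j+1)/10` and offset `m/5`; the level `t` grows with `j` to make the
  -- failure probabilities summable.
  choose A hAm hAc hA using fun (j : ℕ) (m : ℤ) =>
    exists_measurableSet_rampLoss_deviation D hn (r := Rω) (R := R) (Λ := ((j : ℝ) + 1) / 10)
      (t := (15 / 8 * √L + (j + 1) / 10) / √n) hRω hR0 (by positivity) ((m : ℝ) / 5) (ht0 j)
  -- Off this event some sample point has norm at least `R`, so `R ≤ dataNorm S`.
  set bad₁ : Set (Fin n → EuclideanSpace ℝ (Fin d) × ℝ) := {S | ∀ i, ‖(S i).1‖ < R} with hbad₁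
  set bad₂ : Set (Fin n → EuclideanSpace ℝ (Fin d) × ℝ) :=
    ⋃ j : ℕ, ⋃ m ∈ Finset.Icc (-(7 + j : ℤ)) (7 + j), (A j m)ᶜ with hbad₂
  have hbad₁m : MeasurableSet bad₁ := by
    have : bad₁ = ⋂ i, {S | ‖(S i).1‖ < R} := by
      ext S
      simp [hbad₁]
    rw [this]
    exact MeasurableSet.iInter fun i =>
      measurableSet_lt (hNm.comp (measurable_pi_apply i)) measurable_const
  have hbad₂m : MeasurableSet bad₂ := MeasurableSet.iUnion fun j =>
    Finset.measurableSet_biUnion _ fun m _ => (hAm j m).compl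
  have hμ₁ : (Measure.pi fun _ : Fin n => D) bad₁ ≤ ENNReal.ofReal (δ / 2) := by
    have := measure_pi_forall_lt_le (n := n) D hNm hη0.le hRge
    rwa [hη, mul_div_cancel₀ _ hn'.ne', hexpL] at this
  have hμ₂ : (Measure.pi fun _ : Fin n => D) bad₂ ≤ ENNReal.ofReal (δ / 2) := by
    rw [← hexpL]
    refine le_trans ?_ (tsum_grid_failure_le hL2 hsL)
    refine (measure_iUnion_le _).trans (ENNReal.tsum_le_tsum fun j => ?_)
    refine (measure_biUnion_finset_le _ _).trans (Finset.sum_le_sum fun m _ => ?_)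
    refine (hAc j m).trans (le_of_eq ?_)
    rw [div_pow, Real.sq_sqrt hn'.le]
    congr 3
    field_simp
  refine ⟨(bad₁ ∪ bad₂)ᶜ, (hbad₁m.union hbad₂m).compl, ?_, ?_⟩
  · rw [prob_compl_eq_one_sub (hbad₁m.union hbad₂m), ENNReal.ofReal_sub _ hδ0.le,
      ENNReal.ofReal_one]
    refine tsub_le_tsub_left ((measure_union_le _ _).trans ((add_le_add hμ₁ hμ₂).trans ?_)) 1
    rw [← ENNReal.ofReal_add (by positivity) (by positivity), add_halves]
  intro S hS k lam hk hlam hsupp f hf θ hθ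
  have hRx : R ≤ dataNorm S := by
    have h1 : ¬ ∀ i, ‖(S i).1‖ < R := fun h => hS (Or.inl h)
    push Not at h1
    obtain ⟨i, hi⟩ := h1
    exact hi.trans (le_iSup_of_finite (fun i => ‖(S i).1‖) i)
  obtain ⟨g, hg, hfg⟩ := hf.exists_mem_frequencyClass hk hRω hR0 hθ hlam hsupp
  set Λ := √Rlam * Rω * R / θ with hΛ
  have hΛ0 : 0 ≤ Λ := by positivity
  -- This `j` satisfies `Λ < (j+1)/10 ≤ Λ + 1/10`, and the grid index bound becomes `6 + j/2`,
  -- within the range `7 + j`.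
  set j := ⌊10 * Λ⌋₊ with hj
  have hj1 : (j : ℝ) ≤ 10 * Λ := Nat.floor_le (by positivity)
  have hj2 : 10 * Λ < j + 1 := Nat.lt_floor_add_one _
  have hgj := frequencyClass_mono (by linarith : Λ ≤ ((j : ℝ) + 1) / 10) hg
  obtain ⟨m, hm, hmramp⟩ := exists_grid_offset (f 0 / θ) (Λ := ((j : ℝ) + 1) / 10) (by positivity)
  have hmem : m ∈ Finset.Icc (-(7 + j : ℤ)) (7 + j) := by
    have hj0 : (0 : ℝ) ≤ j := Nat.cast_nonneg j
    have hm' := abs_le.1 hm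
    rw [Finset.mem_Icc]
    constructor
    · have : (-(7 + j) : ℝ) ≤ m := by linarith [hm'.1]
      exact_mod_cast this
    · have : (m : ℝ) ≤ 7 + j := by linarith [hm'.2]
      exact_mod_cast this
  have hSA : S ∈ A j m := by
    by_contra h
    exact hS (Or.inr (Set.mem_iUnion.2 ⟨j, Set.mem_iUnion₂.2 ⟨m, hmem, h⟩⟩))
  have hmain := measureReal_le_of_rampLoss_deviation D S hθ hfg
    (fun z hz => abs_apply_le_of_mem_frequencyClass hgj hz) hmramp (hA j m S hSA g hgj)
  have hterm : 6 * Λ / √n ≤ 6 * Rω * dataNorm S / θ * √(Rlam / n) := by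
    have hRl : 0 ≤ Rlam := measureReal_nonneg.trans hlam
    rw [Real.sqrt_div hRl]
    have e : 6 * Λ / √n = 6 * Rω * R / θ * (√Rlam / √n) := by
      rw [hΛ]
      ring
    rw [e]
    gcongr
  -- The complexity and the level together give `6(j+1)/10 ≤ 6Λ + 3/5`, and `3/5 ≤ (8/3 - 15/8)√L`
  -- as `√L ≥ 4/5`. The remaining `√η / 3` pays for the mass outside the ball.
  have hbudget : 5 * (((j : ℝ) + 1) / 10) / √n + (15 / 8 * √L + (j + 1) / 10) / √n
      ≤ 6 * Λ / √n + 8 / 3 * (√L / √n) := by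
    rw [← add_div, ← mul_div_assoc (8 / 3), ← add_div]
    refine div_le_div_of_nonneg_right ?_ hsn.le
    linarith
  rw [hsqrtdiv]
  rw [hsqrtdiv] at hηsqrt
  linarith
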